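/- Let $q\ge 2$ be a prime power, let $\mathbb F_q$ be the field with $q$ elements, and let $n\ge 3$ be an integer. For an $n\times n$ matrix $X$ over $\mathbb F_q$ acting by right multiplication on the row space $V=\mathbb F_q^{1\times n}$, and a monic irreducible polynomial $g\in\mathbb F_q[t]$, the $g$-primary component of $V$ is $V(g)=\{v\in V : v\,g(X)^k=0\text{ for some }k\ge 0\}$; it is called cyclic if $V(g)$ is spanned by $v,vX,vX^2,\dots$ for some $v\in V(g)$. The matrix $X$ is called uncyclic if $V(g)$ is not cyclic for every monic irreducible divisor $g$ of the characteristic polynomial of $X$. Let $\mathrm{unc}(n,q)$ be the number of uncyclic $n\times n$ matrices over $\mathbb F_q$. Then \[ q^{n^2-n-1}\left(1+\frac{n-1}{2}\,q^{-1}-q^{-3}\right)\le \mathrm{unc}(n,q), \] with equality if and only if $n=3$ (so the inequality is strict for all $n\ge 4$). -/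

import Mathlib

open Polynomial

/-- For an endomorphism `φ` of `V` and a polynomial `g`, the `g`-primary component
`V(g)` of `V`: all vectors annihilated by some power of `g(φ)`. -/
def primaryComponent {F V : Type*} [Field F] [AddCommGroup V] [Module F V]
    (φ : Module.End F V) (g : F[X]) : Submodule F V where
  carrier := {v | ∃ k : ℕ, ((aeval φ g) ^ k) v = 0}
  zero_mem' := ⟨0, map_zero _⟩
  add_mem' := by
    rintro v w ⟨k, hk⟩ ⟨l, hl⟩
    refine ⟨k + l, ?_⟩
    have h1 : ((aeval φ g) ^ (k + l)) v = 0 := by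
      rw [add_comm, pow_add, Module.End.mul_apply, hk, map_zero]
    have h2 : ((aeval φ g) ^ (k + l)) w = 0 := by
      rw [pow_add, Module.End.mul_apply, hl, map_zero]
    rw [map_add, h1, h2, add_zero]
  smul_mem' := by
    rintro c v ⟨k, hk⟩
    exact ⟨k, by rw [map_smul, hk, smul_zero]⟩

/-- A `φ`-invariant subspace `W` is cyclic (as an `F[φ]`-module): it is spanned by the
iterates `v, φ v, φ² v, …` of a single vector `v` (which then lies in `W`). -/
def IsCyclicSubspace {F V : Type*} [Field F] [AddCommGroup V] [Module F V]
    (φ : Module.End F V) (W : Submodule F V) : Prop :=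
  ∃ v : V, Submodule.span F (Set.range fun i : ℕ => (φ ^ i) v) = W

/-- A square matrix `A`, acting on row vectors by right multiplication, is uncyclic if for
every monic irreducible divisor `g` of its characteristic polynomial the `g`-primary
component of the space of row vectors is not cyclic. -/
def IsUncyclic {F : Type*} [Field F] {n : ℕ} (A : Matrix (Fin n) (Fin n) F) : Prop :=
  ∀ g : F[X], g.Monic → Irreducible g → g ∣ A.charpoly →
    ¬ IsCyclicSubspace A.vecMulLinear (primaryComponent A.vecMulLinear g)

/-- The number of uncyclic `n × n` matrices over `F`. -/
noncomputable def unc (n : ℕ) (F : Type*) [Field F] : ℕ :=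
  Nat.card {A : Matrix (Fin n) (Fin n) F // IsUncyclic A}

/-! Write x = 1/q. The bound counts only uncyclic matrices whose eigenvalues all lie in the field
and number at most two.

One eigenvalue a: the matrix is a + N with N nilpotent and N^(n-1) = 0, that is, N not regular. By
Fine and Herstein there are q^(n^2-n) nilpotent matrices (`card_nilpotent_matrix`): by Fitting's
lemma every matrix splits into a nilpotent and an invertible part, which gives a recursion in n that
telescopes. Pairs of a regular nilpotent and a cyclic vector are the same as bases, so the regular
ones number |GL_n| / ((q-1) q^(n-1)) (`card_regularNilpotent`). The difference is q^(n^2-n) (1 -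
(1-x^2)(1-x^3)⋯(1-x^n)), and a takes q values.

Two eigenvalues a ≠ b of multiplicities k and n-k, both at least 2: the matrix is conjugate to a
block sum of two such matrices, and `card_blockConj` counts conjugates of block sums with separated
spectra. Each choice of {a,b} and k contributes at least q^(n^2-n-4)/(1-x). There are q^2(1-x)/2
pairs and n-3 values of k, so 1-x cancels and the total is at least q^(n^2-n-2)(n-3)/2.

Truncating the product to (1-x^2)(1-x^3) turns the sum of the two counts into exactly the stated
bound. For n ≥ 4 the omitted factor 1-x^4 makes it strict. For n = 3 nothing is omitted and no
two-eigenvalue case occurs; there every uncyclic matrix has a single eigenvalue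
(`exists_eq_of_isUncyclic_three`), which gives equality. -/

section Criterion

/-! ### Criteria for non-cyclic primary components -/

variable {F V : Type*} [Field F] [AddCommGroup V] [Module F V]

/-- A subspace annihilated by `(φ - a) ^ m` whose dimension exceeds `m` is not cyclic. -/
theorem not_isCyclicSubspace_of_lt_finrank (φ : Module.End F V) (W : Submodule F V) (a : F)
    (m : ℕ) (hW : ∀ v ∈ W, ((φ - a • (1 : Module.End F V)) ^ m) v = 0)
    (hm : m < Module.finrank F W) : ¬ IsCyclicSubspace φ W := by
  rintro ⟨v, hv⟩
  have hvW : v ∈ W := by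
    rw [← hv]
    exact Submodule.subset_span ⟨0, by simp⟩
  set ψ := φ - a • (1 : Module.End F V) with hψ
  let s : Fin m → V := fun j => (ψ ^ (j : ℕ)) v
  -- Since φ = ψ + a, the binomial theorem puts every iterate of v in the span of the ψ^j v, and
  -- only j < m contribute.
  have hle : W ≤ Submodule.span F (Set.range s) := by
    rw [← hv, Submodule.span_le]
    rintro _ ⟨i, rfl⟩
    have hφ : φ = ψ + a • (1 : Module.End F V) := by rw [hψ]; abel
    have hc : Commute ψ (a • (1 : Module.End F V)) := (Commute.one_right ψ).smul_right a
    simp only [SetLike.mem_coe]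
    rw [hφ, hc.add_pow, LinearMap.sum_apply]
    refine Submodule.sum_mem _ fun j _ => ?_
    have hj : (ψ ^ j) v ∈ Submodule.span F (Set.range s) := by
      by_cases hjm : j < m
      · exact Submodule.subset_span ⟨⟨j, hjm⟩, rfl⟩
      · have : (ψ ^ j) v = 0 := by
          rw [← Nat.sub_add_cancel (not_lt.mp hjm), pow_add, Module.End.mul_apply, hW v hvW,
            map_zero]
        rw [this]
        exact Submodule.zero_mem _
    have : (ψ ^ j * (a • (1 : Module.End F V)) ^ (i - j) * ((i.choose j : ℕ) : Module.End F V)) v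
        = ((i.choose j : F) * a ^ (i - j)) • (ψ ^ j) v := by
      rw [_root_.smul_pow, one_pow, mul_smul_comm, mul_one, Module.End.mul_apply, Module.End.natCast_apply,
        LinearMap.smul_apply, map_nsmul, mul_smul, ← Nat.cast_smul_eq_nsmul F, smul_comm]
    rw [this]
    exact Submodule.smul_mem _ _ hj
  have h1 : Module.finrank F (Submodule.span F (Set.range s)) ≤ m := by
    have := finrank_range_le_card (R := F) s
    rwa [Fintype.card_fin] at this
  have : Module.Finite F (Submodule.span F (Set.range s)) :=
    Module.Finite.span_of_finite F (Set.finite_range s)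
  exact absurd ((Submodule.finrank_mono hle).trans h1) (not_le.mpr hm)

theorem primaryComponent_X_sub_C (φ : Module.End F V) (a : F) :
    primaryComponent φ (X - C a) = φ.maxGenEigenspace a := by
  ext v
  rw [Module.End.mem_maxGenEigenspace]
  change (∃ k : ℕ, ((aeval φ (X - C a)) ^ k) v = 0) ↔ _
  simp [Algebra.algebraMap_eq_smul_one]

end Criterion

/-! ### Uncyclicity read off from an annihilating polynomial -/

section MatrixCriterion

variable {F : Type*} [Field F] {n : ℕ}

theorem vecMulLinear_pow (A : Matrix (Fin n) (Fin n) F) (i : ℕ) :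
    (A.vecMulLinear : Module.End F (Fin n → F)) ^ i = (A ^ i).vecMulLinear := by
  induction i with
  | zero => ext; simp
  | succ i ih =>
    rw [pow_succ, ih, pow_succ']
    refine LinearMap.ext fun v => ?_
    simp [Module.End.mul_apply, Matrix.vecMul_vecMul]

theorem aeval_vecMulLinear (A : Matrix (Fin n) (Fin n) F) (p : F[X]) :
    aeval (A.vecMulLinear : Module.End F (Fin n → F)) p = (aeval A p).vecMulLinear := by
  induction p using Polynomial.induction_on' with
  | add p q hp hq =>
    rw [map_add, map_add, hp, hq]
    refine LinearMap.ext fun v => ?_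
    simp
  | monomial i c =>
    rw [aeval_monomial, aeval_monomial, vecMulLinear_pow]
    refine LinearMap.ext fun v => ?_
    simp [Algebra.algebraMap_eq_smul_one]

theorem charpoly_vecMulLinear (A : Matrix (Fin n) (Fin n) F) :
    (A.vecMulLinear : Module.End F (Fin n → F)).charpoly = A.charpoly := by
  rw [← Matrix.mulVecLin_transpose, Matrix.charpoly_mulVecLin, Matrix.charpoly_transpose]

theorem finrank_maxGenEigenspace_vecMulLinear (A : Matrix (Fin n) (Fin n) F) (a : F) :
    Module.finrank F (Module.End.maxGenEigenspace (A.vecMulLinear : Module.End F (Fin n → F)) a)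
      = A.charpoly.rootMultiplicity a := by
  rw [LinearMap.finrank_maxGenEigenspace_eq, charpoly_vecMulLinear]

/-- The factor h is coprime to X - a, hence invertible on the primary component, so (X - a)^m alone
already kills that component. Its dimension is the multiplicity of a, which exceeds m. -/
theorem isUncyclic_of_aeval_eq_zero (A : Matrix (Fin n) (Fin n) F)
    (hA : ∀ g : F[X], g.Monic → Irreducible g → g ∣ A.charpoly → ∃ (a : F) (m : ℕ) (h : F[X]),
      g = X - C a ∧ m < A.charpoly.rootMultiplicity a ∧ h.eval a ≠ 0 ∧
        aeval A ((X - C a) ^ m * h) = 0) : IsUncyclic A := by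
  intro g hg hgi hgd
  obtain ⟨a, m, h, rfl, hm, hh, h0⟩ := hA g hg hgi hgd
  set φ : Module.End F (Fin n → F) := A.vecMulLinear with hφ
  rw [primaryComponent_X_sub_C]
  refine not_isCyclicSubspace_of_lt_finrank φ _ a m (fun v hv => ?_)
    (by rwa [finrank_maxGenEigenspace_vecMulLinear])
  obtain ⟨k, hk⟩ := (Module.End.mem_maxGenEigenspace φ a v).mp hv
  have hψ : ∀ i, (φ - a • (1 : Module.End F (Fin n → F))) ^ i = aeval φ ((X - C a) ^ i) := by
    intro i
    simp [Algebra.algebraMap_eq_smul_one]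
  have hcop : IsCoprime ((X - C a) ^ k) h :=
    ((irreducible_X_sub_C a).coprime_iff_not_dvd.mpr
      (fun hd => hh (dvd_iff_isRoot.mp hd))).pow_left
  obtain ⟨u, w, huw⟩ := hcop
  have h0' : aeval φ ((X - C a) ^ m * h) = 0 := by
    rw [hφ, aeval_vecMulLinear, h0]
    ext; simp
  rw [hψ] at hk ⊢
  have : (X - C a) ^ m = ((X - C a) ^ m * u) * (X - C a) ^ k + w * ((X - C a) ^ m * h) := by
    linear_combination (-(X - C a) ^ m) * huw
  rw [this, map_add, map_mul, map_mul _ w, h0', mul_zero, add_zero, Module.End.mul_apply, hk,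
    map_zero]

theorem eq_X_sub_C_of_dvd_pow {g : F[X]} (hg : g.Monic) (hgi : Irreducible g) {a : F} {k : ℕ}
    (h : g ∣ (X - C a) ^ k) : g = X - C a :=
  eq_of_monic_of_associated hg (monic_X_sub_C a)
    (hgi.associated_of_dvd (irreducible_X_sub_C a) (hgi.prime.dvd_of_dvd_pow h))

theorem isUncyclic_of_charpoly_eq_pow (A : Matrix (Fin n) (Fin n) F) (a : F) (hn : 1 ≤ n)
    (hc : A.charpoly = (X - C a) ^ n) (h0 : aeval A ((X - C a) ^ (n - 1)) = 0) :
    IsUncyclic A := by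
  refine isUncyclic_of_aeval_eq_zero A fun g hg hgi hgd =>
    ⟨a, n - 1, 1, ?_, ?_, by simp, by rwa [mul_one]⟩
  · rw [hc] at hgd
    exact eq_X_sub_C_of_dvd_pow hg hgi hgd
  · rw [hc, rootMultiplicity_X_sub_C_pow]
    omega

theorem rootMultiplicity_pow_mul_pow {a b : F} (hab : a ≠ b) (k l : ℕ) :
    ((X - C a) ^ k * (X - C b) ^ l).rootMultiplicity a = k := by
  rw [rootMultiplicity_mul (mul_ne_zero (pow_ne_zero _ (X_sub_C_ne_zero a))
    (pow_ne_zero _ (X_sub_C_ne_zero b))), rootMultiplicity_X_sub_C_pow,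
    rootMultiplicity_eq_zero, add_zero]
  simp [IsRoot, sub_eq_zero, hab]

theorem isUncyclic_of_charpoly_eq_pow_mul_pow (A : Matrix (Fin n) (Fin n) F) {a b : F}
    (hab : a ≠ b) {k l : ℕ} (hk : 1 ≤ k) (hl : 1 ≤ l)
    (hc : A.charpoly = (X - C a) ^ k * (X - C b) ^ l)
    (h0 : aeval A ((X - C a) ^ (k - 1) * (X - C b) ^ (l - 1)) = 0) :
    IsUncyclic A := by
  refine isUncyclic_of_aeval_eq_zero A fun g hg hgi hgd => ?_
  rw [hc] at hgd
  rcases hgi.prime.dvd_or_dvd hgd with h | h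
  · refine ⟨a, k - 1, (X - C b) ^ (l - 1), eq_X_sub_C_of_dvd_pow hg hgi h, ?_, ?_, h0⟩
    · rw [hc, rootMultiplicity_pow_mul_pow hab]
      omega
    · simp [sub_eq_zero, hab]
  · refine ⟨b, l - 1, (X - C a) ^ (k - 1), eq_X_sub_C_of_dvd_pow hg hgi h, ?_, ?_, ?_⟩
    · rw [hc, mul_comm, rootMultiplicity_pow_mul_pow hab.symm]
      omega
    · simp [sub_eq_zero, hab.symm]
    · rwa [mul_comm]

end MatrixCriterion

/-! ### Counting conjugates of block sums with separated spectra -/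

section BlockConj

open Matrix

variable {F : Type*} [Field F] {m n : Type*} [Fintype m] [Fintype n] [DecidableEq m]
  [DecidableEq n]

/-- The matrices conjugate to a block diagonal matrix with blocks in `S` and in `T`. -/
def blockConj (S : Set (Matrix m m F)) (T : Set (Matrix n n F)) :
    Set (Matrix (m ⊕ n) (m ⊕ n) F) :=
  {M | ∃ P : (Matrix (m ⊕ n) (m ⊕ n) F)ˣ, ∃ A ∈ S, ∃ B ∈ T,
    M = P.1 * fromBlocks A 0 0 B * (P⁻¹).1}

/-- The block diagonal unit with the given blocks. -/
def blockUnit (Q : (Matrix m m F)ˣ) (R : (Matrix n n F)ˣ) : (Matrix (m ⊕ n) (m ⊕ n) F)ˣ where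
  val := fromBlocks Q.1 0 0 R.1
  inv := fromBlocks (Q⁻¹).1 0 0 (R⁻¹).1
  val_inv := by simp [fromBlocks_multiply]
  inv_val := by simp [fromBlocks_multiply]

/-- The relation passes to powers: X (A - a)^i = (B - a)^i X. For large i the left side vanishes
while (B - a)^i stays invertible. -/
theorem eq_zero_of_mul_eq_mul_of_isNilpotent {X : Matrix n m F} {A : Matrix m m F}
    {B : Matrix n n F} (a : F) (hA : IsNilpotent (A - scalar m a)) (hB : IsUnit (B - scalar n a))
    (h : X * A = B * X) : X = 0 := by
  have h1 : X * (A - scalar m a) = (B - scalar n a) * X := by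
    rw [Matrix.mul_sub, Matrix.sub_mul, h]
    simp [scalar_apply, ← smul_one_eq_diagonal]
  have h2 : ∀ i, X * (A - scalar m a) ^ i = (B - scalar n a) ^ i * X := by
    intro i
    induction i with
    | zero => simp
    | succ i ih =>
      rw [pow_succ, ← Matrix.mul_assoc, ih, Matrix.mul_assoc, h1, ← Matrix.mul_assoc, ← pow_succ]
  obtain ⟨i, hi⟩ := hA
  have h3 := h2 i
  rw [hi, Matrix.mul_zero] at h3
  obtain ⟨u, hu⟩ := hB.pow i
  rw [← hu] at h3
  calc X = (u⁻¹).1 * (u.1 * X) := by rw [← Matrix.mul_assoc, u.inv_mul, Matrix.one_mul]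
    _ = 0 := by rw [← h3, Matrix.mul_zero]

theorem eq_zero_of_mul_eq_mul_of_isUnit {Y : Matrix m n F} {A : Matrix m m F}
    {B : Matrix n n F} (a : F) (hA : IsNilpotent (A - scalar m a)) (hB : IsUnit (B - scalar n a))
    (h : Y * B = A * Y) : Y = 0 := by
  have h1 : Yᵀ * Aᵀ = Bᵀ * Yᵀ := by rw [← transpose_mul, ← transpose_mul, h]
  have ht : Yᵀ = 0 := by
    refine eq_zero_of_mul_eq_mul_of_isNilpotent a ?_ ?_ h1
    · obtain ⟨i, hi⟩ := hA
      refine ⟨i, ?_⟩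
      have : (A - scalar m a)ᵀ ^ i = 0 := by rw [← transpose_pow, hi, transpose_zero]
      simpa [scalar_apply] using this
    · have := (isUnit_transpose (A := B - scalar n a)).mpr hB
      simpa [scalar_apply] using this
  simpa using congrArg transpose ht

/-- A unit intertwining two block diagonal matrices with separated spectra is block diagonal. -/
theorem exists_eq_blockUnit {A A' : Matrix m m F} {B B' : Matrix n n F} (a : F)
    (hA : IsNilpotent (A - scalar m a)) (hB : IsUnit (B - scalar n a))
    (hA' : IsNilpotent (A' - scalar m a)) (hB' : IsUnit (B' - scalar n a))
    (R : (Matrix (m ⊕ n) (m ⊕ n) F)ˣ)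
    (h : fromBlocks A 0 0 B * R.1 = R.1 * fromBlocks A' 0 0 B') :
    ∃ Q₁ Q₂, R = blockUnit Q₁ Q₂ := by
  -- Applied to R and to its inverse, so that the diagonal blocks of the two are inverse to each
  -- other.
  have key : ∀ {A A' : Matrix m m F} {B B' : Matrix n n F} (R : Matrix (m ⊕ n) (m ⊕ n) F),
      IsNilpotent (A - scalar m a) → IsUnit (B - scalar n a) →
      IsNilpotent (A' - scalar m a) → IsUnit (B' - scalar n a) →
      fromBlocks A 0 0 B * R = R * fromBlocks A' 0 0 B' →
      R = fromBlocks R.toBlocks₁₁ 0 0 R.toBlocks₂₂ := by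
    intro A A' B B' R hA hB hA' hB' h
    rw [← fromBlocks_toBlocks R, fromBlocks_multiply, fromBlocks_multiply, fromBlocks_inj] at h
    obtain ⟨-, h12, h21, -⟩ := h
    simp only [Matrix.zero_mul, Matrix.mul_zero, add_zero, zero_add] at h12 h21
    have e12 := eq_zero_of_mul_eq_mul_of_isUnit a hA hB' h12.symm
    have e21 := eq_zero_of_mul_eq_mul_of_isNilpotent a hA' hB h21.symm
    conv_lhs => rw [← fromBlocks_toBlocks R, e12, e21]
  have hR := key R.1 hA hB hA' hB' h
  have h' : fromBlocks A' 0 0 B' * (R⁻¹).1 = (R⁻¹).1 * fromBlocks A 0 0 B := by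
    calc _ = (R⁻¹).1 * (R.1 * fromBlocks A' 0 0 B') * (R⁻¹).1 := by
            rw [← mul_assoc, R.inv_mul, one_mul]
      _ = _ := by rw [← h, mul_assoc, mul_assoc, R.mul_inv, mul_one]
  have hR' := key (R⁻¹).1 hA' hB' hA hB h'
  have h1 := R.mul_inv
  have h2 := R.inv_mul
  rw [hR, hR', fromBlocks_multiply, ← fromBlocks_one, fromBlocks_inj] at h1 h2
  simp only [Matrix.mul_zero, add_zero, zero_add] at h1 h2
  refine ⟨⟨_, _, h1.1, h2.1⟩, ⟨_, _, h1.2.2.2, h2.2.2.2⟩, ?_⟩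
  ext1
  exact hR

/-- Fix one decomposition M = P diag(A, B) P⁻¹ for each M. Any other one differs from it by a unit
intertwining the two block sums, which is block diagonal, so the decompositions of M form a torsor
under GL_m × GL_n. Both sides count triples of a unit and two blocks. -/
theorem card_blockConj (S : Set (Matrix m m F)) (T : Set (Matrix n n F)) (a : F)
    (hS : ∀ A ∈ S, IsNilpotent (A - scalar m a)) (hT : ∀ B ∈ T, IsUnit (B - scalar n a))
    (hSc : ∀ (Q : (Matrix m m F)ˣ), ∀ A ∈ S, (Q⁻¹).1 * A * Q.1 ∈ S)
    (hTc : ∀ (Q : (Matrix n n F)ˣ), ∀ B ∈ T, (Q⁻¹).1 * B * Q.1 ∈ T) :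
    Nat.card (blockConj S T) * (Nat.card (Matrix m m F)ˣ * Nat.card (Matrix n n F)ˣ) =
      Nat.card (Matrix (m ⊕ n) (m ⊕ n) F)ˣ * (Nat.card S * Nat.card T) := by
  have hex : ∀ M : blockConj S T, ∃ P : (Matrix (m ⊕ n) (m ⊕ n) F)ˣ, ∃ A ∈ S, ∃ B ∈ T,
    M.1 = P.1 * fromBlocks A 0 0 B * (P⁻¹).1 := fun M => M.2
  choose P A hA B hB hM using hex
  rw [← Nat.card_prod, ← Nat.card_prod, ← Nat.card_prod, ← Nat.card_prod]
  let f : blockConj S T × ((Matrix m m F)ˣ × (Matrix n n F)ˣ) →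
      (Matrix (m ⊕ n) (m ⊕ n) F)ˣ × (S × T) := fun x =>
    (P x.1 * blockUnit x.2.1 x.2.2,
      ⟨(x.2.1⁻¹).1 * A x.1 * x.2.1.1, hSc _ _ (hA _)⟩,
      ⟨(x.2.2⁻¹).1 * B x.1 * x.2.2.1, hTc _ _ (hB _)⟩)
  have hblock : ∀ (Q : (Matrix m m F)ˣ) (R : (Matrix n n F)ˣ) (A : Matrix m m F)
      (B : Matrix n n F), (blockUnit Q R).1 *
        fromBlocks ((Q⁻¹).1 * A * Q.1) 0 0 ((R⁻¹).1 * B * R.1) * ((blockUnit Q R)⁻¹).1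
        = fromBlocks A 0 0 B := by
    intro Q R A B
    change fromBlocks Q.1 0 0 R.1 * _ * fromBlocks (Q⁻¹).1 0 0 (R⁻¹).1 = _
    rw [fromBlocks_multiply, fromBlocks_multiply]
    simp [← Matrix.mul_assoc]
  -- The image of x determines M; this gives the main part of injectivity.
  have hf : ∀ x, x.1.1 = (f x).1.1 * fromBlocks (f x).2.1.1 0 0 (f x).2.2.1 * ((f x).1⁻¹).1 := by
    intro x
    rw [hM x.1, ← hblock x.2.1 x.2.2]
    simp only [f, _root_.mul_inv_rev, Units.val_mul, mul_assoc]
  refine Nat.card_congr (Equiv.ofBijective f ⟨?_, ?_⟩)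
  · rintro ⟨M, Q, R⟩ ⟨M', Q', R'⟩ h
    have hMM : M = M' := by
      apply Subtype.ext
      rw [hf ⟨M, Q, R⟩, hf ⟨M', Q', R'⟩, h]
    subst hMM
    have h1 := mul_left_cancel (congrArg Prod.fst h)
    have h2 : fromBlocks Q.1 0 0 R.1 = fromBlocks Q'.1 0 0 R'.1 := congrArg Units.val h1
    rw [fromBlocks_inj] at h2
    rw [Units.ext h2.1, Units.ext h2.2.2.2]
  · rintro ⟨P', ⟨A', hA'⟩, ⟨B', hB'⟩⟩
    let M : blockConj S T := ⟨P'.1 * fromBlocks A' 0 0 B' * (P'⁻¹).1, P', A', hA', B', hB', rfl⟩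
    have hMP : P'.1 * fromBlocks A' 0 0 B' * (P'⁻¹).1 =
      (P M).1 * fromBlocks (A M) 0 0 (B M) * ((P M)⁻¹).1 := hM M
    have hint : fromBlocks (A M) 0 0 (B M) * ((P M)⁻¹ * P').1 =
        ((P M)⁻¹ * P').1 * fromBlocks A' 0 0 B' := by
      calc _ = ((P M)⁻¹).1 * ((P M).1 * fromBlocks (A M) 0 0 (B M) * ((P M)⁻¹).1) * P'.1 := by
              simp only [← mul_assoc, Units.inv_mul, one_mul, Units.val_mul]
        _ = _ := by
              rw [← hMP]
              simp only [mul_assoc, Units.inv_mul, mul_one, Units.val_mul]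
    obtain ⟨Q, R, hQR⟩ := exists_eq_blockUnit a (hS _ (hA M)) (hT _ (hB M)) (hS _ hA') (hT _ hB')
      _ hint
    have hP : P M * blockUnit Q R = P' := by rw [← hQR, mul_inv_cancel_left]
    rw [hQR] at hint
    have hint' : fromBlocks (A M) 0 0 (B M) * fromBlocks Q.1 0 0 R.1 =
      fromBlocks Q.1 0 0 R.1 * fromBlocks A' 0 0 B' := hint
    rw [fromBlocks_multiply, fromBlocks_multiply, fromBlocks_inj] at hint'
    obtain ⟨h1, -, -, h2⟩ := hint'
    simp only [Matrix.mul_zero, add_zero, zero_add] at h1 h2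
    refine ⟨⟨M, Q, R⟩, ?_⟩
    have e1 : (Q⁻¹).1 * A M * Q.1 = A' := by rw [mul_assoc, h1, ← mul_assoc, Q.inv_mul, one_mul]
    have e2 : (R⁻¹).1 * B M * R.1 = B' := by rw [mul_assoc, h2, ← mul_assoc, R.inv_mul, one_mul]
    simp only [f, Prod.mk.injEq, Subtype.mk.injEq]
    exact ⟨hP, e1, e2⟩

end BlockConj

/-! ### Counting regular nilpotents through cyclic vectors -/

section RegularNilpotent

variable {F V : Type*} [Field F] [AddCommGroup V] [Module F V]

theorem linearIndependent_pow_apply {φ : Module.End F V} {m : ℕ} {v : V}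
    (h0 : φ ^ (m + 1) = 0) (hv : (φ ^ m) v ≠ 0) :
    LinearIndependent F fun i : Fin (m + 1) => (φ ^ (i : ℕ)) v := by
  rw [Fintype.linearIndependent_iff]
  intro c hc
  have hz : ∀ j, m + 1 ≤ j → (φ ^ j) v = 0 := by
    intro j hj
    rw [← Nat.sub_add_cancel hj, pow_add, h0, mul_zero, LinearMap.zero_apply]
  have key : ∀ N : ℕ, ∀ i : Fin (m + 1), (i : ℕ) = N → c i = 0 := by
    intro N
    induction N using Nat.strong_induction_on with
    | _ N ih =>
      rintro i rfl
      -- Earlier coefficients vanish by induction, and φ^(m-i) kills the later terms, isolating c i.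
      have h1 := congrArg (φ ^ (m - (i : ℕ))) hc
      rw [map_sum, map_zero, Finset.sum_eq_single i] at h1
      · rw [map_smul, ← Module.End.mul_apply, ← pow_add,
          Nat.sub_add_cancel (Nat.lt_succ_iff.mp i.2)] at h1
        exact (smul_eq_zero.mp h1).resolve_right hv
      · intro j _ hji
        rcases lt_or_gt_of_ne hji with h | h
        · rw [ih j h j rfl, zero_smul, map_zero]
        · rw [map_smul, ← Module.End.mul_apply, ← pow_add, hz _ (by omega), smul_zero]
      · simp
  exact fun i => key i i rfl

/-- The basis `v, φ v, …, φ ^ m v` given by a vector not annihilated by `φ ^ m`. -/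
noncomputable def powBasis {φ : Module.End F V} {m : ℕ} (hd : Module.finrank F V = m + 1) {v : V}
    (h0 : φ ^ (m + 1) = 0) (hv : (φ ^ m) v ≠ 0) : Module.Basis (Fin (m + 1)) F V :=
  basisOfLinearIndependentOfCardEqFinrank (linearIndependent_pow_apply h0 hv) (by simp [hd])

theorem powBasis_apply {φ : Module.End F V} {m : ℕ} (hd : Module.finrank F V = m + 1) {v : V}
    (h0 : φ ^ (m + 1) = 0) (hv : (φ ^ m) v ≠ 0) (i : Fin (m + 1)) :
    powBasis hd h0 hv i = (φ ^ (i : ℕ)) v := by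
  simp [powBasis]

/-- φ^m kills every basis vector but the first, so being cyclic depends on one coordinate only.
Hence there are (q-1) q^m cyclic vectors, whatever φ is. -/
theorem pow_apply_ne_zero_iff {φ : Module.End F V} {m : ℕ} (hd : Module.finrank F V = m + 1)
    {v : V} (h0 : φ ^ (m + 1) = 0) (hv : (φ ^ m) v ≠ 0) (w : V) :
    (φ ^ m) w ≠ 0 ↔ (powBasis hd h0 hv).equivFun w 0 ≠ 0 := by
  set b := powBasis hd h0 hv with hb
  have h1 : (φ ^ m) w = b.equivFun w 0 • (φ ^ m) v := by
    conv_lhs => rw [← b.sum_equivFun w]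
    rw [map_sum, Finset.sum_eq_single 0]
    · rw [map_smul, hb, powBasis_apply]
      simp
    · intro j _ hj
      have hj' : 1 ≤ (j : ℕ) := Nat.one_le_iff_ne_zero.mpr fun h => hj (Fin.ext h)
      rw [map_smul, hb, powBasis_apply, ← Module.End.mul_apply, ← pow_add,
        show m + (j : ℕ) = (j - 1 : ℕ) + (m + 1) by omega, pow_add, h0, mul_zero,
        LinearMap.zero_apply, smul_zero]
    · simp
  rw [h1, smul_ne_zero_iff]
  exact and_iff_left hv

theorem card_fun_zero_ne_zero [Finite F] (m : ℕ) :
    Nat.card {c : Fin (m + 1) → F // c 0 ≠ 0} = (Nat.card F - 1) * Nat.card F ^ m := by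
  let e : {c : Fin (m + 1) → F // c 0 ≠ 0} ≃ {x : F // x ≠ 0} × (Fin m → F) :=
    { toFun := fun c => (⟨c.1 0, c.2⟩, fun i => c.1 i.succ)
      invFun := fun x => ⟨Fin.cons x.1.1 x.2, by simpa using x.1.2⟩
      left_inv := fun c => by
        apply Subtype.ext
        exact Fin.cons_self_tail c.1
      right_inv := fun x => by simp }
  rw [Nat.card_congr e, Nat.card_prod, Nat.card_fun]
  have : Nat.card {x : F // x ≠ 0} = Nat.card F - 1 := by
    have := Fintype.ofFinite F
    classical
    rw [Nat.card_eq_fintype_card, Nat.card_eq_fintype_card, Fintype.card_subtype_compl]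
    simp
  simp [this]

/-- Pairs of a regular nilpotent endomorphism and a cyclic vector correspond to bases. -/
noncomputable def regularNilpotentPairEquiv (m : ℕ) (hd : Module.finrank F V = m + 1) :
    (Σ φ : {φ : Module.End F V // φ ^ (m + 1) = 0 ∧ φ ^ m ≠ 0}, {v : V // (φ.1 ^ m) v ≠ 0}) ≃
      {s : Fin (m + 1) → V // LinearIndependent F s} := by
  refine Equiv.ofBijective
    (fun x => ⟨fun i => (x.1.1 ^ (i : ℕ)) x.2.1, linearIndependent_pow_apply x.1.2.1 x.2.2⟩) ⟨?_, ?_⟩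
  · rintro ⟨⟨φ, h0, h1⟩, ⟨v, hv⟩⟩ ⟨⟨ψ, h0', h1'⟩, ⟨w, hw⟩⟩ h
    have h2 : ∀ i : Fin (m + 1), (φ ^ (i : ℕ)) v = (ψ ^ (i : ℕ)) w :=
      fun i => congrFun (congrArg Subtype.val h) i
    have hvw : v = w := by simpa using h2 0
    subst hvw
    -- Both maps shift the common basis; on its last vector both give zero, by nilpotency.
    have : φ = ψ := by
      refine (powBasis hd h0 hv).ext fun i => ?_
      rw [powBasis_apply]
      conv_rhs => rw [h2 i]
      rw [← Module.End.mul_apply, ← Module.End.mul_apply, ← pow_succ', ← pow_succ']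
      by_cases hi : (i : ℕ) + 1 < m + 1
      · exact h2 ⟨i + 1, hi⟩
      · rw [show (i : ℕ) + 1 = m + 1 by omega, h0, h0']
    subst this
    rfl
  · rintro ⟨s, hs⟩
    let b := basisOfLinearIndependentOfCardEqFinrank hs (by simp [hd])
    have hbs : ∀ i, b i = s i := fun i => by simp [b]
    let φ : Module.End F V :=
      b.constr F fun i => if h : (i : ℕ) + 1 < m + 1 then s ⟨i + 1, h⟩ else 0
    have hφ : ∀ i, φ (s i) = if h : (i : ℕ) + 1 < m + 1 then s ⟨i + 1, h⟩ else 0 := by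
      intro i
      rw [← hbs i]
      exact b.constr_basis F _ i
    have hpow : ∀ (j : ℕ) (i : Fin (m + 1)), (φ ^ j) (s i) =
        if h : (i : ℕ) + j < m + 1 then s ⟨i + j, h⟩ else 0 := by
      intro j
      induction j with
      | zero =>
        intro i
        rw [dif_pos (by rw [add_zero]; exact i.2)]
        simp
      | succ j ih =>
        intro i
        rw [pow_succ', Module.End.mul_apply, ih]
        by_cases h : (i : ℕ) + j < m + 1
        · rw [dif_pos h, hφ]
          simp only [add_assoc]
        · rw [dif_neg h, dif_neg (by omega), map_zero]
    have h0 : φ ^ (m + 1) = 0 := by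
      refine b.ext fun i => ?_
      rw [hbs, hpow, dif_neg (by omega)]
      rfl
    have hs0 : ∀ i : Fin (m + 1), (φ ^ (i : ℕ)) (s 0) = s i := by
      intro i
      rw [hpow, dif_pos (by rw [Fin.val_zero, zero_add]; exact i.2)]
      congr 1
      ext
      simp
    have hne : (φ ^ m) (s 0) ≠ 0 := by
      have := hs0 (Fin.last m)
      rw [Fin.val_last] at this
      rw [this]
      exact hs.ne_zero _
    refine ⟨⟨⟨φ, h0, fun h => hne (by rw [h]; rfl)⟩, ⟨s 0, hne⟩⟩, ?_⟩
    apply Subtype.ext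
    funext i
    exact hs0 i

/-- The pairs (φ, cyclic vector) are counted twice: as bases, and fibrewise over φ with fibres of
constant size. -/
theorem card_regularNilpotent_end [FiniteDimensional F V] [Finite F] (m : ℕ) (hd : Module.finrank F V = m + 1) :
    Nat.card {φ : Module.End F V // φ ^ (m + 1) = 0 ∧ φ ^ m ≠ 0} *
      ((Nat.card F - 1) * Nat.card F ^ m) =
      Nat.card {s : Fin (m + 1) → V // LinearIndependent F s} := by
  have : Finite V := Module.finite_of_finite F
  have : Finite (Module.End F V) := Module.finite_of_finite F
  have := Fintype.ofFinite {φ : Module.End F V // φ ^ (m + 1) = 0 ∧ φ ^ m ≠ 0}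
  rw [← Nat.card_congr (regularNilpotentPairEquiv m hd), Nat.card_sigma]
  have hfib : ∀ φ : {φ : Module.End F V // φ ^ (m + 1) = 0 ∧ φ ^ m ≠ 0},
      Nat.card {v : V // (φ.1 ^ m) v ≠ 0} = (Nat.card F - 1) * Nat.card F ^ m := by
    rintro ⟨φ, h0, h1⟩
    obtain ⟨v, hv⟩ : ∃ v, (φ ^ m) v ≠ 0 := by
      by_contra! h
      exact h1 (LinearMap.ext h)
    rw [← card_fun_zero_ne_zero]
    exact Nat.card_congr ((powBasis hd h0 hv).equivFun.toEquiv.subtypeEquiv fun w =>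
      pow_apply_ne_zero_iff hd h0 hv w)
  rw [Finset.sum_congr rfl fun φ _ => hfib φ]
  simp [Nat.card_eq_fintype_card]

end RegularNilpotent

theorem card_GL_eq_prod {F : Type*} [Field F] [Finite F] (n : ℕ) :
    Nat.card (Matrix (Fin n) (Fin n) F)ˣ =
      ∏ i : Fin n, (Nat.card F ^ n - Nat.card F ^ (i : ℕ)) := by
  have := Fintype.ofFinite F
  rw [Nat.card_eq_fintype_card (α := F)]
  exact Matrix.card_GL_field n

/-- The number of regular nilpotent matrices, multiplied by the size of a centralizer. -/
theorem card_regularNilpotent {F : Type*} [Field F] [Finite F] (m : ℕ) :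
    Nat.card {A : Matrix (Fin (m + 1)) (Fin (m + 1)) F // A ^ (m + 1) = 0 ∧ A ^ m ≠ 0} *
      ((Nat.card F - 1) * Nat.card F ^ m) =
      Nat.card (Matrix (Fin (m + 1)) (Fin (m + 1)) F)ˣ := by
  have e : {A : Matrix (Fin (m + 1)) (Fin (m + 1)) F // A ^ (m + 1) = 0 ∧ A ^ m ≠ 0} ≃
      {φ : Module.End F (Fin (m + 1) → F) // φ ^ (m + 1) = 0 ∧ φ ^ m ≠ 0} :=
    Matrix.toLinAlgEquiv'.toEquiv.subtypeEquiv fun A => by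
      change _ ↔ Matrix.toLinAlgEquiv' A ^ (m + 1) = 0 ∧ Matrix.toLinAlgEquiv' A ^ m ≠ 0
      simp only [← map_pow, ne_eq, map_eq_zero_iff _ Matrix.toLinAlgEquiv'.injective]
  have := Fintype.ofFinite F
  rw [Nat.card_congr e, card_regularNilpotent_end m (by simp), card_GL_eq_prod,
    card_linearIndependent (by simp)]
  simp [Nat.card_eq_fintype_card]

/-! ### Fitting decomposition -/

section Fitting

open Matrix

variable {F : Type*} [Field F]

theorem isNilpotent_charpoly {n : Type*} [Fintype n] [DecidableEq n] {A : Matrix n n F}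
    (h : IsNilpotent A) : A.charpoly = X ^ Fintype.card n := by
  rw [← sub_eq_zero]
  exact (Matrix.isNilpotent_charpoly_sub_pow_of_isNilpotent h).eq_zero

theorem isUnit_iff_rootMultiplicity_zero {n : Type*} [Fintype n] [DecidableEq n]
    (B : Matrix n n F) : IsUnit B ↔ B.charpoly.rootMultiplicity 0 = 0 := by
  rw [rootMultiplicity_eq_zero_iff, IsRoot.def, eval_charpoly, Matrix.isUnit_iff_isUnit_det,
    isUnit_iff_ne_zero]
  have := (charpoly_monic B).ne_zero
  simp [this, det_neg]

/-- The basis is adapted to the Fitting splitting of V into the union of the kernels and the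
intersection of the ranges of the powers of φ. -/
theorem exists_basis_toMatrix_eq_fromBlocks {V : Type*} [AddCommGroup V] [Module F V]
    [FiniteDimensional F V] (φ : Module.End F V) {k l : ℕ} (hd : Module.finrank F V = k + l)
    (hk : φ.charpoly.rootMultiplicity 0 = k) :
    ∃ (b : Module.Basis (Fin k ⊕ Fin l) F V) (A : Matrix (Fin k) (Fin k) F)
      (B : Matrix (Fin l) (Fin l) F), IsNilpotent A ∧
        LinearMap.toMatrix b b φ = fromBlocks A 0 0 B := by
  set V₀ := φ.maxGenEigenspace 0 with hV₀
  have hV : V₀ = ⨆ n : ℕ, LinearMap.ker (φ ^ n) := by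
    simp [V₀, ← Module.End.iSup_genEigenspace_eq, Module.End.genEigenspace_nat]
  let W := ⨅ n : ℕ, LinearMap.range (φ ^ n)
  have hVW : IsCompl V₀ W := by
    rw [hV]
    exact LinearMap.isCompl_iSup_ker_pow_iInf_range_pow φ
  have hφV : ∀ x ∈ V₀, φ x ∈ V₀ := by
    simp only [V₀, Module.End.mem_maxGenEigenspace, zero_smul, sub_zero, forall_exists_index]
    intro x n hx
    use n
    rw [← Module.End.mul_apply, ← pow_succ, pow_succ', Module.End.mul_apply, hx, map_zero]
  have hφW : ∀ x ∈ W, φ x ∈ W := by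
    simp only [W, Submodule.mem_iInf, LinearMap.mem_range]
    intro x H n
    obtain ⟨y, rfl⟩ := H n
    use φ y
    rw [← Module.End.mul_apply, ← pow_succ, pow_succ', Module.End.mul_apply]
  have hdV : Module.finrank F V₀ = k := by rw [← hk, ← φ.finrank_maxGenEigenspace_eq]
  have hdW : Module.finrank F W = l := by
    have := Submodule.finrank_add_eq_of_isCompl hVW
    omega
  let bV := Module.finBasisOfFinrankEq F V₀ hdV
  let bW := Module.finBasisOfFinrankEq F W hdW
  let f := φ.restrict hφV
  let g := φ.restrict hφW
  let e := Submodule.prodEquivOfIsCompl V₀ W hVW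
  have he : ∀ x, φ (e x) = e (f.prodMap g x) := by
    intro x
    simp [e, f, g]
  have hf : IsNilpotent f := by
    rw [LinearMap.isNilpotent_iff_charpoly, LinearMap.charpoly_eq_X_pow_iff]
    rintro ⟨x, hx⟩
    obtain ⟨n, hn⟩ := (Module.End.mem_maxGenEigenspace φ 0 x).mp hx
    refine ⟨n, Subtype.ext ?_⟩
    rw [zero_smul, sub_zero] at hn
    rw [Module.End.pow_restrict]
    exact hn
  refine ⟨(bV.prod bW).map e, LinearMap.toMatrix bV bV f, LinearMap.toMatrix bW bW g, ?_, ?_⟩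
  · obtain ⟨n, hn⟩ := hf
    refine ⟨n, ?_⟩
    rw [LinearMap.toMatrix_pow, hn, map_zero]
  · rw [← LinearMap.toMatrix_prodMap]
    ext i j
    rw [LinearMap.toMatrix_apply, LinearMap.toMatrix_apply, Module.Basis.map_apply, he,
      Module.Basis.map_repr]
    simp

/-- The multiplicity of the root 0 records the size of the nilpotent Fitting block, so grouping all
matrices by it lets `card_blockConj` count each group. -/
theorem mem_blockConj_nilpotent_unit_iff {k l : ℕ} (M : Matrix (Fin k ⊕ Fin l) (Fin k ⊕ Fin l) F) :
    M ∈ blockConj {A : Matrix (Fin k) (Fin k) F | IsNilpotent A}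
      {B : Matrix (Fin l) (Fin l) F | IsUnit B} ↔ M.charpoly.rootMultiplicity 0 = k := by
  have hmul : ∀ (A : Matrix (Fin k) (Fin k) F) (B : Matrix (Fin l) (Fin l) F), IsNilpotent A →
      (fromBlocks A 0 0 B).charpoly.rootMultiplicity 0 = k + B.charpoly.rootMultiplicity 0 := by
    intro A B hA
    rw [charpoly_fromBlocks_zero₁₂, rootMultiplicity_mul
      (mul_ne_zero (charpoly_monic A).ne_zero (charpoly_monic B).ne_zero), isNilpotent_charpoly hA,
      ← sub_zero X, ← C_0, rootMultiplicity_X_sub_C_pow, Fintype.card_fin]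
  constructor
  · rintro ⟨P, A, hA, B, hB, rfl⟩
    rw [Matrix.coe_units_inv, charpoly_units_conj, hmul A B hA,
      (isUnit_iff_rootMultiplicity_zero B).mp hB, add_zero]
  · intro h
    obtain ⟨b, A, B, hA, hAB⟩ := exists_basis_toMatrix_eq_fromBlocks (k := k) (l := l)
      (Matrix.toLin' M) (by simp) (by rwa [Matrix.charpoly_toLin'])
    let s := Pi.basisFun F (Fin k ⊕ Fin l)
    let P : (Matrix (Fin k ⊕ Fin l) (Fin k ⊕ Fin l) F)ˣ :=
      ⟨s.toMatrix b, b.toMatrix s, s.toMatrix_mul_toMatrix_flip b, b.toMatrix_mul_toMatrix_flip s⟩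
    have hM : M = P.1 * fromBlocks A 0 0 B * (P⁻¹).1 := by
      rw [← hAB]
      change M = s.toMatrix b * _ * b.toMatrix s
      rw [basis_toMatrix_mul_linearMap_toMatrix_mul_basis_toMatrix]
      simp [s, LinearMap.toMatrix_eq_toMatrix']
    refine ⟨P, A, hA, B, ?_, hM⟩
    rw [hM, Matrix.coe_units_inv, charpoly_units_conj, hmul A B hA] at h
    exact (isUnit_iff_rootMultiplicity_zero B).mpr (by omega)

theorem card_units_matrix_sum (k l : ℕ) :
    Nat.card (Matrix (Fin k ⊕ Fin l) (Fin k ⊕ Fin l) F)ˣ =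
      Nat.card (Matrix (Fin (k + l)) (Fin (k + l)) F)ˣ :=
  Nat.card_congr (Units.mapEquiv
    (reindexAlgEquiv F F (finSumFinEquiv (m := k) (n := l))).toMulEquiv).toEquiv

theorem pow_card_eq_zero_of_isNilpotent {n : ℕ} {A : Matrix (Fin n) (Fin n) F}
    (h : IsNilpotent A) : A ^ n = 0 := by
  have := aeval_self_charpoly A
  rwa [isNilpotent_charpoly h, map_pow, aeval_X, Fintype.card_fin] at this

end Fitting

/-! ### Orders of general linear groups and counts of nilpotent matrices -/

section Counts

open Matrix

variable {F : Type*} [Field F] [Finite F]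

theorem two_le_card_field : (2 : ℝ) ≤ Nat.card F := by
  exact_mod_cast Finite.one_lt_card (α := F)

/-- The product `(1 - x) (1 - x ^ 2) ⋯ (1 - x ^ n)`. -/
noncomputable def oneSubPowProd (x : ℝ) (n : ℕ) : ℝ := ∏ i ∈ Finset.range n, (1 - x ^ (i + 1))

theorem oneSubPowProd_succ (x : ℝ) (n : ℕ) :
    oneSubPowProd x (n + 1) = oneSubPowProd x n * (1 - x ^ (n + 1)) :=
  Finset.prod_range_succ _ _

theorem oneSubPowProd_pos {x : ℝ} (h0 : 0 ≤ x) (h1 : x < 1) (n : ℕ) : 0 < oneSubPowProd x n :=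
  Finset.prod_pos fun i _ => sub_pos.mpr (pow_lt_one₀ h0 h1 (Nat.succ_ne_zero i))

theorem card_units_matrix (n : ℕ) :
    (Nat.card (Matrix (Fin n) (Fin n) F)ˣ : ℝ) =
      (Nat.card F : ℝ) ^ (n ^ 2) * oneSubPowProd (Nat.card F : ℝ)⁻¹ n := by
  have hq : (1 : ℝ) ≤ Nat.card F := by linarith [two_le_card_field (F := F)]
  have hq0 : (Nat.card F : ℝ) ≠ 0 := by positivity
  rw [card_GL_eq_prod, Nat.cast_prod]
  have h1 : ∀ i : Fin n, ((Nat.card F ^ n - Nat.card F ^ (i : ℕ) : ℕ) : ℝ) =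
      (Nat.card F : ℝ) ^ n * (1 - (Nat.card F : ℝ)⁻¹ ^ (n - i)) := by
    intro i
    rw [Nat.cast_sub (Nat.pow_le_pow_right Nat.card_pos i.2.le), inv_pow]
    push_cast
    rw [mul_sub, mul_one, ← pow_sub₀ _ hq0 (Nat.sub_le _ _), Nat.sub_sub_self i.2.le]
  rw [Finset.prod_congr rfl fun i _ => h1 i, Finset.prod_mul_distrib, Finset.prod_const,
    Finset.card_univ, Fintype.card_fin, ← pow_mul, ← sq,
    Fin.prod_univ_eq_prod_range (fun i => 1 - (Nat.card F : ℝ)⁻¹ ^ (n - i)) n,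
    ← Finset.prod_range_reflect]
  congr 1
  refine Finset.prod_congr rfl fun i hi => ?_
  rw [Finset.mem_range] at hi
  congr 2
  omega

/-- An instance of `card_blockConj`: the invertible block ranges over all of GL_l, so |GL_l|
cancels. -/
theorem card_nilpotent_mul_card_units (k l : ℕ) :
    Nat.card {M : Matrix (Fin (k + l)) (Fin (k + l)) F // M.charpoly.rootMultiplicity 0 = k} *
      Nat.card (Matrix (Fin k) (Fin k) F)ˣ =
    Nat.card (Matrix (Fin (k + l)) (Fin (k + l)) F)ˣ *
      Nat.card {A : Matrix (Fin k) (Fin k) F // IsNilpotent A} := by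
  have h := card_blockConj {A : Matrix (Fin k) (Fin k) F | IsNilpotent A}
    {B : Matrix (Fin l) (Fin l) F | IsUnit B} 0 (fun A hA => by simpa using hA)
    (fun B hB => by simpa using hB)
    (fun Q A hA => by
      obtain ⟨i, hi⟩ := hA
      refine ⟨i, ?_⟩
      have := Units.conj_pow Q⁻¹ A i
      rw [inv_inv] at this
      rw [this, hi, mul_zero, zero_mul])
    (fun Q B hB => (Q⁻¹.isUnit.mul hB).mul Q.isUnit)
  have hu : Nat.card {B : Matrix (Fin l) (Fin l) F | IsUnit B} =
      Nat.card (Matrix (Fin l) (Fin l) F)ˣ :=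
    Nat.card_congr (Equiv.ofBijective (fun u : (Matrix (Fin l) (Fin l) F)ˣ =>
      (⟨u.1, u.isUnit⟩ : {B : Matrix (Fin l) (Fin l) F | IsUnit B}))
      ⟨fun u v h => Units.ext (congrArg Subtype.val h), fun ⟨B, hB⟩ =>
        ⟨hB.unit, rfl⟩⟩).symm
  have hb : Nat.card (blockConj {A : Matrix (Fin k) (Fin k) F | IsNilpotent A}
      {B : Matrix (Fin l) (Fin l) F | IsUnit B}) =
      Nat.card {M : Matrix (Fin (k + l)) (Fin (k + l)) F //
        M.charpoly.rootMultiplicity 0 = k} :=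
    Nat.card_congr ((Matrix.reindex finSumFinEquiv finSumFinEquiv).subtypeEquiv fun M => by
      rw [charpoly_reindex]
      exact mem_blockConj_nilpotent_unit_iff M)
  rw [hu, hb, card_units_matrix_sum, ← mul_assoc, ← mul_assoc] at h
  exact Nat.eq_of_mul_eq_mul_right Nat.card_pos h

theorem sum_card_nilpotent_div_card_units (n : ℕ) :
    ∑ k ∈ Finset.range (n + 1), (Nat.card {A : Matrix (Fin k) (Fin k) F // IsNilpotent A} : ℝ) /
      Nat.card (Matrix (Fin k) (Fin k) F)ˣ =
    (Nat.card F : ℝ) ^ (n ^ 2) / Nat.card (Matrix (Fin n) (Fin n) F)ˣ := by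
  classical
  have := Fintype.ofFinite F
  have hpos : ∀ k, (0 : ℝ) < Nat.card (Matrix (Fin k) (Fin k) F)ˣ :=
    fun k => by exact_mod_cast Nat.card_pos
  have h1 := Finset.card_eq_sum_card_fiberwise (s := (Finset.univ : Finset (Matrix (Fin n) (Fin n) F)))
    (f := fun M => M.charpoly.rootMultiplicity 0) (t := Finset.range (n + 1)) (by
      intro M _
      have : M.charpoly.rootMultiplicity 0 ≤ M.charpoly.natDegree := by
        classical
        rw [← count_roots]
        exact (Multiset.count_le_card _ _).trans (card_roots' _)
      simp only [Finset.coe_range, Set.mem_Iio]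
      rw [charpoly_natDegree_eq_dim, Fintype.card_fin] at this
      omega)
  have h2 : (Finset.univ : Finset (Matrix (Fin n) (Fin n) F)).card = Nat.card F ^ (n ^ 2) := by
    rw [Finset.card_univ, ← Nat.card_eq_fintype_card]
    change Nat.card (Fin n → Fin n → F) = _
    rw [Nat.card_fun, Nat.card_fun]
    simp [← pow_mul, sq]
  rw [h2] at h1
  rw [eq_div_iff (hpos n).ne', ← Nat.cast_pow, h1, Nat.cast_sum, Finset.sum_mul]
  refine Finset.sum_congr rfl fun k hk => ?_
  obtain ⟨l, rfl⟩ := Nat.exists_eq_add_of_le (Nat.lt_succ_iff.mp (Finset.mem_range.mp hk))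
  have h3 := card_nilpotent_mul_card_units (F := F) k l
  have h4 : (Finset.univ.filter fun M : Matrix (Fin (k + l)) (Fin (k + l)) F =>
      M.charpoly.rootMultiplicity 0 = k).card =
      Nat.card {M : Matrix (Fin (k + l)) (Fin (k + l)) F // M.charpoly.rootMultiplicity 0 = k} := by
    rw [Nat.card_eq_fintype_card, Fintype.card_subtype]
  rw [h4, div_mul_eq_mul_div, div_eq_iff (hpos k).ne']
  rw [mul_comm]
  exact_mod_cast h3.symm

/-- The Fine-Herstein theorem: there are `q ^ (n ^ 2 - n)` nilpotent matrices. -/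
theorem card_nilpotent_matrix (n : ℕ) :
    (Nat.card {A : Matrix (Fin n) (Fin n) F // IsNilpotent A} : ℝ) =
      (Nat.card F : ℝ) ^ (n ^ 2 - n) := by
  have hq := two_le_card_field (F := F)
  have hq0 : (Nat.card F : ℝ) ≠ 0 := by positivity
  have h0 : (0 : ℝ) ≤ (Nat.card F : ℝ)⁻¹ := by positivity
  have hx1 : (Nat.card F : ℝ)⁻¹ < 1 := inv_lt_one_of_one_lt₀ (by linarith)
  have hpos : ∀ k, (0 : ℝ) < Nat.card (Matrix (Fin k) (Fin k) F)ˣ :=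
    fun k => by exact_mod_cast Nat.card_pos
  cases n with
  | zero =>
    have h := sum_card_nilpotent_div_card_units (F := F) 0
    rw [Finset.sum_range_one, div_left_inj' (hpos 0).ne'] at h
    exact h
  | succ n =>
    have h := sum_card_nilpotent_div_card_units (F := F) (n + 1)
    -- Subtracting the identities for n + 1 and n leaves only the top term.
    rw [Finset.sum_range_succ, sum_card_nilpotent_div_card_units n, ← eq_sub_iff_add_eq',
      div_eq_iff (hpos _).ne', card_units_matrix, card_units_matrix, oneSubPowProd_succ] at h
    rw [h]
    have hπ := (oneSubPowProd_pos h0 hx1 n).ne'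
    have hπ' : 1 - (Nat.card F : ℝ)⁻¹ ^ (n + 1) ≠ 0 :=
      (sub_pos.mpr (pow_lt_one₀ h0 hx1 (Nat.succ_ne_zero n))).ne'
    have hQ := pow_ne_zero ((n + 1) ^ 2) hq0
    have hQ' := pow_ne_zero (n ^ 2) hq0
    rw [pow_sub₀ _ hq0 (Nat.le_self_pow two_ne_zero _), ← inv_pow]
    generalize (Nat.card F : ℝ) ^ ((n + 1) ^ 2) = a at hQ ⊢
    generalize (Nat.card F : ℝ) ^ (n ^ 2) = c at hQ' ⊢
    generalize oneSubPowProd (Nat.card F : ℝ)⁻¹ n = p at hπ ⊢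
    generalize (Nat.card F : ℝ)⁻¹ ^ (n + 1) = y at hπ' ⊢
    field_simp
    ring

/-- All nilpotents minus the regular ones. The factor 1 - x of |GL_(m+1)|, with x = 1/q, cancels
against the q - 1 counting cyclic vectors, so the product starts at exponent 2. -/
theorem card_nonregular_nilpotent (m : ℕ) :
    (Nat.card {A : Matrix (Fin (m + 1)) (Fin (m + 1)) F // A ^ m = 0} : ℝ) =
      (Nat.card F : ℝ) ^ (m ^ 2 + m) *
        (1 - ∏ i ∈ Finset.range m, (1 - (Nat.card F : ℝ)⁻¹ ^ (i + 2))) := by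
  classical
  have := Fintype.ofFinite F
  have hq := two_le_card_field (F := F)
  have hq0 : (Nat.card F : ℝ) ≠ 0 := by positivity
  have h1 : Nat.card {A : Matrix (Fin (m + 1)) (Fin (m + 1)) F // IsNilpotent A} =
      Nat.card {A : Matrix (Fin (m + 1)) (Fin (m + 1)) F // A ^ m = 0} +
      Nat.card {A : Matrix (Fin (m + 1)) (Fin (m + 1)) F // A ^ (m + 1) = 0 ∧ A ^ m ≠ 0} := by
    simp only [Nat.card_eq_fintype_card, Fintype.card_subtype]
    rw [← Finset.card_union_of_disjoint]
    · congr 1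
      ext A
      simp only [Finset.mem_filter, Finset.mem_univ, true_and, Finset.mem_union]
      constructor
      · intro h
        by_cases h0 : A ^ m = 0
        · exact Or.inl h0
        · exact Or.inr ⟨pow_card_eq_zero_of_isNilpotent h, h0⟩
      · rintro (h | h)
        · exact ⟨m, h⟩
        · exact ⟨m + 1, h.1⟩
    · rw [Finset.disjoint_filter]
      exact fun A _ h h' => h'.2 h
  have h2 := card_regularNilpotent (F := F) m
  have h3 := congrArg (Nat.cast (R := ℝ)) h1
  have h4 := congrArg (Nat.cast (R := ℝ)) h2
  rw [card_units_matrix, oneSubPowProd, Finset.prod_range_succ'] at h4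
  rw [card_nilpotent_matrix] at h3
  push_cast [Nat.cast_sub (Nat.card_pos (α := F))] at h3 h4
  set Q := (Nat.card F : ℝ)
  set R := ∏ i ∈ Finset.range m, (1 - Q⁻¹ ^ (i + 2)) with hR
  have e1 : (m + 1) ^ 2 - (m + 1) = m ^ 2 + m := by
    rw [Nat.sub_eq_iff_eq_add (Nat.le_self_pow two_ne_zero _)]
    ring
  rw [e1] at h3
  have e2 : Q ^ ((m + 1) ^ 2) = Q ^ (m ^ 2 + m) * (Q * Q ^ m) := by
    rw [← pow_succ', ← pow_add]
    congr 1
    ring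
  rw [e2] at h4
  have hne : (Q - 1) * Q ^ m ≠ 0 := mul_ne_zero (by linarith) (pow_ne_zero _ hq0)
  have h5 : (Nat.card {A : Matrix (Fin (m + 1)) (Fin (m + 1)) F // A ^ (m + 1) = 0 ∧ A ^ m ≠ 0} : ℝ)
      = Q ^ (m ^ 2 + m) * R := by
    apply mul_right_cancel₀ hne
    rw [h4, hR]
    field_simp
  rw [h5] at h3
  linarith

end Counts

/-- Chooses one ordering of each two-element subset, so that an unordered pair of eigenvalues is
never counted twice. -/
theorem exists_finset_pairs (F : Type*) [Finite F] : ∃ P : Finset (F × F),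
    2 * P.card = Nat.card F * Nat.card F - Nat.card F ∧
      (∀ p ∈ P, p.1 ≠ p.2) ∧ ∀ p ∈ P, ∀ p' ∈ P, p.1 = p'.2 → p.2 ≠ p'.1 := by
  classical
  have := Fintype.ofFinite F
  let e := Finite.equivFin F
  refine ⟨Finset.univ.filter fun p : F × F => e p.1 < e p.2, ?_, ?_, ?_⟩
  · have h1 := Finset.offDiag_card (Finset.univ : Finset F)
    rw [Finset.card_univ, ← Nat.card_eq_fintype_card] at h1
    rw [← h1, two_mul]
    have h2 : (Finset.univ.filter fun p : F × F => e p.1 < e p.2).card =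
        (Finset.univ.filter fun p : F × F => e p.2 < e p.1).card :=
      Finset.card_equiv (Equiv.prodComm F F) (by simp)
    conv_lhs => rw [h2]
    conv_lhs => enter [2]; rw [← h2]
    rw [← Finset.card_union_of_disjoint]
    · congr 1
      ext p
      simp only [Finset.mem_union, Finset.mem_filter, Finset.mem_univ, true_and,
        Finset.mem_offDiag]
      rw [← lt_or_lt_iff_ne.trans (e.injective.ne_iff (x := p.1) (y := p.2)), or_comm]
    · rw [Finset.disjoint_filter]
      exact fun p _ h h' => lt_asymm h h'
  · intro p hp h
    simp [h] at hp
  · intro p hp p' hp' h h'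
    simp only [Finset.mem_filter, Finset.mem_univ, true_and] at hp hp'
    rw [h, h'] at hp
    exact lt_asymm hp hp'

/-! ### Matrices with one or two eigenvalues in the field -/

section Families

open Matrix

variable {F : Type*} [Field F]

theorem charpoly_of_sub_scalar_nilpotent {n : Type*} [Fintype n] [DecidableEq n]
    {A : Matrix n n F} {a : F} (h : IsNilpotent (A - scalar n a)) :
    A.charpoly = (X - C a) ^ Fintype.card n := by
  have h1 := charpoly_sub_scalar (A - scalar n a) (-a)
  rw [isNilpotent_charpoly h, map_neg, sub_neg_eq_add, sub_add_cancel] at h1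
  rw [h1, X_pow_comp, map_neg, ← sub_eq_add_neg]

theorem aeval_X_sub_C_matrix {n : Type*} [Fintype n] [DecidableEq n]
    (A : Matrix n n F) (a : F) : aeval A (X - C a) = A - scalar n a := by
  simp [Matrix.algebraMap_eq_diagonal, Pi.algebraMap_def]

theorem card_singleEigenvalue (m : ℕ) (a : F) :
    Nat.card {A : Matrix (Fin (m + 1)) (Fin (m + 1)) F | A.charpoly = (X - C a) ^ (m + 1) ∧
      aeval A ((X - C a) ^ m) = 0} =
    Nat.card {A : Matrix (Fin (m + 1)) (Fin (m + 1)) F // A ^ m = 0} := by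
  refine Nat.card_congr ((Equiv.subRight (scalar _ a)).subtypeEquiv fun A => ?_)
  rw [Set.mem_ofPred_eq, map_pow, aeval_X_sub_C_matrix]
  refine ⟨fun h => h.2, fun h => ⟨?_, h⟩⟩
  simpa using charpoly_of_sub_scalar_nilpotent (A := A) (a := a) ⟨m, h⟩

theorem card_sub_scalar_pow_eq_zero (m : ℕ) (a : F) :
    Nat.card {A : Matrix (Fin (m + 1)) (Fin (m + 1)) F | (A - scalar _ a) ^ m = 0} =
    Nat.card {A : Matrix (Fin (m + 1)) (Fin (m + 1)) F // A ^ m = 0} :=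
  Nat.card_congr ((Equiv.subRight (scalar _ a)).subtypeEquiv fun _ => Iff.rfl)

theorem conj_sub_scalar {n : Type*} [Fintype n] [DecidableEq n] (P : (Matrix n n F)ˣ)
    (A : Matrix n n F) (a : F) :
    P.1 * A * (P⁻¹).1 - scalar n a = P.1 * (A - scalar n a) * (P⁻¹).1 := by
  have h : P.1 * scalar n a * (P⁻¹).1 = scalar n a := by
    rw [(scalar_commute a (fun r' => mul_comm a r') P.1).symm.eq, mul_assoc, P.mul_inv, mul_one]
  rw [mul_sub, sub_mul, h]

theorem conj_sub_scalar_pow {n : Type*} [Fintype n] [DecidableEq n] (P : (Matrix n n F)ˣ)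
    (A : Matrix n n F) (a : F) (i : ℕ) :
    (P.1 * A * (P⁻¹).1 - scalar n a) ^ i = P.1 * (A - scalar n a) ^ i * (P⁻¹).1 := by
  rw [conj_sub_scalar, Units.conj_pow]

theorem fromBlocks_sub_scalar {m n : Type*} [Fintype m] [Fintype n] [DecidableEq m]
    [DecidableEq n] (A : Matrix m m F) (B : Matrix n n F) (a : F) :
    fromBlocks A 0 0 B - scalar (m ⊕ n) a =
      fromBlocks (A - scalar m a) 0 0 (B - scalar n a) := by
  ext (i | i) (j | j) <;> simp [diagonal_apply]

theorem blockConj_subset {i j : ℕ} (a b : F)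
    (M : Matrix (Fin (i + 1) ⊕ Fin (j + 1)) (Fin (i + 1) ⊕ Fin (j + 1)) F)
    (hM : M ∈ blockConj {A : Matrix (Fin (i + 1)) (Fin (i + 1)) F | (A - scalar _ a) ^ i = 0}
      {B : Matrix (Fin (j + 1)) (Fin (j + 1)) F | (B - scalar _ b) ^ j = 0}) :
    M.charpoly = (X - C a) ^ (i + 1) * (X - C b) ^ (j + 1) ∧
      aeval M ((X - C a) ^ i * (X - C b) ^ j) = 0 := by
  obtain ⟨P, A, hA, B, hB, rfl⟩ := hM
  rw [Set.mem_ofPred_eq] at hA hB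
  constructor
  · rw [Matrix.coe_units_inv, charpoly_units_conj, charpoly_fromBlocks_zero₁₂,
      charpoly_of_sub_scalar_nilpotent ⟨i, hA⟩, charpoly_of_sub_scalar_nilpotent ⟨j, hB⟩]
    simp
  · rw [map_mul, map_pow, map_pow, aeval_X_sub_C_matrix, aeval_X_sub_C_matrix,
      conj_sub_scalar_pow, conj_sub_scalar_pow, fromBlocks_sub_scalar, fromBlocks_sub_scalar,
      fromBlocks_diagonal_pow, fromBlocks_diagonal_pow, hA, hB]
    have : ∀ (U W : Matrix (Fin (i + 1) ⊕ Fin (j + 1)) (Fin (i + 1) ⊕ Fin (j + 1)) F), U * W = 0 →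
        P.1 * U * (P⁻¹).1 * (P.1 * W * (P⁻¹).1) = 0 := by
      intro U W h
      calc _ = P.1 * (U * ((P⁻¹).1 * P.1) * W) * (P⁻¹).1 := by simp only [mul_assoc]
        _ = 0 := by rw [P.inv_mul, mul_one, h, mul_zero, zero_mul]
    apply this
    rw [fromBlocks_multiply]
    simp

theorem aeval_reindex {m n : Type*} [Fintype m] [Fintype n] [DecidableEq m] [DecidableEq n]
    (e : m ≃ n) (M : Matrix m m F) (p : F[X]) :
    aeval (reindex e e M) p = reindex e e (aeval M p) :=
  aeval_algHom_apply (reindexAlgEquiv F F e) M p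

/-- The conjugates of block sums inject into the two-eigenvalue family; this containment suffices
for a lower bound. -/
theorem mul_le_card_twoEigenvalue [Finite F] {i j : ℕ} {a b : F} (hab : a ≠ b) :
    Nat.card (Matrix (Fin (i + 1 + (j + 1))) (Fin (i + 1 + (j + 1))) F)ˣ *
      (Nat.card {A : Matrix (Fin (i + 1)) (Fin (i + 1)) F // A ^ i = 0} *
        Nat.card {A : Matrix (Fin (j + 1)) (Fin (j + 1)) F // A ^ j = 0}) ≤
    Nat.card {M : Matrix (Fin (i + 1 + (j + 1))) (Fin (i + 1 + (j + 1))) F |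
      M.charpoly = (X - C a) ^ (i + 1) * (X - C b) ^ (j + 1) ∧
        aeval M ((X - C a) ^ i * (X - C b) ^ j) = 0} *
      (Nat.card (Matrix (Fin (i + 1)) (Fin (i + 1)) F)ˣ *
        Nat.card (Matrix (Fin (j + 1)) (Fin (j + 1)) F)ˣ) := by
  have hc : ∀ (m i : ℕ) (a : F) (Q : (Matrix (Fin m) (Fin m) F)ˣ) (A : Matrix (Fin m) (Fin m) F),
      (A - scalar _ a) ^ i = 0 → ((Q⁻¹).1 * A * Q.1 - scalar _ a) ^ i = 0 := by
    intro m i a Q A h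
    have := conj_sub_scalar_pow Q⁻¹ A a i
    rw [inv_inv] at this
    rw [this, h, mul_zero, zero_mul]
  have h := card_blockConj
    {A : Matrix (Fin (i + 1)) (Fin (i + 1)) F | (A - scalar _ a) ^ i = 0}
    {B : Matrix (Fin (j + 1)) (Fin (j + 1)) F | (B - scalar _ b) ^ j = 0} a
    (fun A hA => ⟨i, hA⟩)
    (fun B hB => by
      -- A nonzero scalar plus a commuting nilpotent is invertible, so the two spectra are
      -- separated.
      have h1 : B - scalar _ a = scalar _ (b - a) + (B - scalar _ b) := by
        rw [map_sub]
        abel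
      rw [h1]
      have hN : IsNilpotent (B - scalar _ b) := ⟨j, hB⟩
      refine hN.isUnit_add_left_of_commute
        ((isUnit_iff_ne_zero.mpr (sub_ne_zero.mpr hab.symm)).map (scalar (Fin (j + 1)))) ?_
      exact (scalar_commute _ (fun r' => Commute.all _ r') _).symm)
    (fun Q A hA => hc _ _ _ Q A hA) (fun Q A hA => hc _ _ _ Q A hA)
  rw [card_sub_scalar_pow_eq_zero, card_sub_scalar_pow_eq_zero, card_units_matrix_sum] at h
  rw [← h]
  refine Nat.mul_le_mul_right _ ?_
  refine Nat.card_le_card_of_injective (fun M => ⟨reindex finSumFinEquiv finSumFinEquiv M.1, ?_⟩) ?_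
  · have := blockConj_subset a b M.1 M.2
    rw [Set.mem_ofPred_eq, charpoly_reindex, aeval_reindex, this.2]
    exact ⟨this.1, by simp⟩
  · intro M M' h
    exact Subtype.ext ((reindex finSumFinEquiv finSumFinEquiv).injective (congrArg Subtype.val h))

theorem sum_card_le_unc [Finite F] {n : ℕ} {ι : Type*} (I : Finset ι) (c : ι → F[X])
    (hc : Set.InjOn c I) (S : ι → Set (Matrix (Fin n) (Fin n) F))
    (hS : ∀ i ∈ I, ∀ A ∈ S i, A.charpoly = c i ∧ IsUncyclic A) :
    ∑ i ∈ I, Nat.card (S i) ≤ unc n F := by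
  classical
  have := Fintype.ofFinite F
  have h1 : ∀ i, Nat.card (S i) = (S i).toFinset.card := fun i => by
    rw [Set.toFinset_card, Nat.card_eq_fintype_card]
  rw [unc, Nat.card_eq_fintype_card, Fintype.card_subtype, Finset.sum_congr rfl fun i _ => h1 i,
    ← Finset.card_biUnion]
  · refine Finset.card_le_card fun A hA => ?_
    obtain ⟨i, hi, hAi⟩ := Finset.mem_biUnion.mp hA
    simpa using (hS i hi A (by simpa using hAi)).2
  · intro i hi j hj hij
    rw [Function.onFun, Finset.disjoint_left]
    intro A hA hA'
    have e1 := (hS i hi A (by simpa using hA)).1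
    have e2 := (hS j hj A (by simpa using hA')).1
    exact hij (hc hi hj (e1.symm.trans e2))

theorem rootMultiplicity_pow_mul_pow_apply [DecidableEq F] (a b z : F) (k l : ℕ) :
    ((X - C a) ^ k * (X - C b) ^ l).rootMultiplicity z =
      (if z = a then k else 0) + (if z = b then l else 0) := by
  have h : ∀ (a : F) (k : ℕ), ((X - C a) ^ k).rootMultiplicity z = if z = a then k else 0 := by
    intro a k
    split_ifs with h
    · rw [h, rootMultiplicity_X_sub_C_pow]
    · rw [rootMultiplicity_eq_zero]
      simp [IsRoot, sub_eq_zero, h]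
  rw [rootMultiplicity_mul (mul_ne_zero (pow_ne_zero _ (X_sub_C_ne_zero a))
    (pow_ne_zero _ (X_sub_C_ne_zero b))), h, h]

end Families

/-! ### Uncyclic 3 × 3 matrices have a single eigenvalue -/

section DimensionThree

open Matrix

variable {F V : Type*} [Field F] [AddCommGroup V] [Module F V]

theorem aeval_apply_mem_span (φ : Module.End F V) (v : V) (p : F[X]) :
    aeval φ p v ∈ Submodule.span F (Set.range fun i : ℕ => (φ ^ i) v) := by
  rw [aeval_eq_sum_range, LinearMap.sum_apply]
  refine Submodule.sum_mem _ fun i _ => Submodule.smul_mem _ _ (Submodule.subset_span ⟨i, rfl⟩)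

theorem isCyclicSubspace_of_finrank_eq_one (φ : Module.End F V) (W : Submodule F V)
    (hφ : ∀ v ∈ W, φ v ∈ W) (hW : Module.finrank F W = 1) : IsCyclicSubspace φ W := by
  obtain ⟨⟨v, hv⟩, -, h⟩ := finrank_eq_one_iff'.mp hW
  refine ⟨v, le_antisymm ?_ fun w hw => ?_⟩
  · rw [Submodule.span_le]
    rintro _ ⟨i, rfl⟩
    change (φ ^ i) v ∈ W
    induction i with
    | zero => simpa
    | succ i ih => rw [pow_succ', Module.End.mul_apply]; exact hφ _ ih
  · obtain ⟨c, hc⟩ := h ⟨w, hw⟩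
    have hw' : c • v = w := congrArg Subtype.val hc
    rw [← hw']
    exact Submodule.smul_mem _ _ (Submodule.subset_span ⟨0, by simp⟩)

/-- Any nonzero v generates: a polynomial of degree below dim V that kills v would be coprime to the
characteristic polynomial, and Bézout would give v = 0. -/
theorem isCyclicSubspace_top_of_irreducible_charpoly [FiniteDimensional F V] [Nontrivial V]
    (φ : Module.End F V) (h : Irreducible φ.charpoly) : IsCyclicSubspace φ ⊤ := by
  obtain ⟨v, hv⟩ := exists_ne (0 : V)
  refine ⟨v, ?_⟩
  have hli : LinearIndependent F fun i : Fin (Module.finrank F V) => (φ ^ (i : ℕ)) v := by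
    rw [Fintype.linearIndependent_iff]
    intro c hc
    let p : F[X] := ∑ i : Fin (Module.finrank F V), C (c i) * X ^ (i : ℕ)
    have hp0 : aeval φ p v = 0 := by
      rw [← hc]
      simp [p, map_sum, LinearMap.sum_apply, Algebra.algebraMap_eq_smul_one]
    have hpd : p.degree < φ.charpoly.degree := by
      rw [degree_eq_natDegree φ.charpoly_monic.ne_zero, LinearMap.charpoly_natDegree]
      exact degree_sum_fin_lt c
    have hp : p = 0 := by
      by_contra hne
      have hcop : IsCoprime φ.charpoly p := h.coprime_iff_not_dvd.mpr fun hd =>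
        absurd (degree_le_of_dvd hd hne) (not_le.mpr hpd)
      obtain ⟨u, w, huw⟩ := hcop
      have := congrArg (fun r => aeval φ r v) huw
      simp only [map_add, map_mul, LinearMap.aeval_self_charpoly, mul_zero, zero_add, map_one,
        Module.End.mul_apply, hp0, map_zero, Module.End.one_apply] at this
      exact hv this.symm
    intro i
    have := congrArg (fun r => r.coeff (i : ℕ)) hp
    simpa [p, finsetSum_coeff, coeff_C_mul, coeff_X_pow, Fin.val_inj] using this
  rw [eq_top_iff, ← hli.span_eq_top_of_card_eq_finrank' (by simp)]
  refine Submodule.span_mono ?_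
  rintro _ ⟨i, rfl⟩
  exact ⟨i, rfl⟩

theorem isCyclicSubspace_top_of_regular (φ : Module.End F V) (a : F) {m : ℕ}
    (hd : Module.finrank F V = m + 1) (h0 : (φ - a • (1 : Module.End F V)) ^ (m + 1) = 0)
    (hm : (φ - a • (1 : Module.End F V)) ^ m ≠ 0) : IsCyclicSubspace φ ⊤ := by
  obtain ⟨v, hv⟩ : ∃ v, ((φ - a • (1 : Module.End F V)) ^ m) v ≠ 0 := by
    by_contra! h
    exact hm (LinearMap.ext h)
  refine ⟨v, ?_⟩
  rw [eq_top_iff, ← (powBasis hd h0 hv).span_eq, Submodule.span_le]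
  rintro _ ⟨i, rfl⟩
  rw [powBasis_apply]
  have : (φ - a • (1 : Module.End F V)) ^ (i : ℕ) = aeval φ ((X - C a) ^ (i : ℕ)) := by
    simp [Algebra.algebraMap_eq_smul_one]
  rw [this]
  exact aeval_apply_mem_span φ v _

theorem primaryComponent_charpoly_eq_top {n : ℕ} (A : Matrix (Fin n) (Fin n) F) {g : F[X]} {k : ℕ}
    (h : A.charpoly = g ^ k) : primaryComponent A.vecMulLinear g = ⊤ := by
  rw [eq_top_iff]
  intro v _
  refine ⟨k, ?_⟩
  rw [← map_pow, ← h, aeval_vecMulLinear, aeval_self_charpoly]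
  simp

/-- A simple root has a one-dimensional primary component, which is cyclic. -/
theorem rootMultiplicity_ne_one_of_isUncyclic {n : ℕ} {A : Matrix (Fin n) (Fin n) F}
    (hA : IsUncyclic A) (a : F) : A.charpoly.rootMultiplicity a ≠ 1 := by
  intro h
  have hr : A.charpoly.IsRoot a := (rootMultiplicity_pos (charpoly_monic A).ne_zero).mp (by omega)
  refine hA (X - C a) (monic_X_sub_C a) (irreducible_X_sub_C a) (dvd_iff_isRoot.mpr hr) ?_
  rw [primaryComponent_X_sub_C]
  refine isCyclicSubspace_of_finrank_eq_one _ _ (fun v hv => ?_)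
    ((finrank_maxGenEigenspace_vecMulLinear A a).trans h)
  exact Module.End.mapsTo_maxGenEigenspace_of_comm (Commute.refl _) a hv

/-- A cubic without roots is irreducible, hence gives a cyclic space. Otherwise some root has
multiplicity at least 2, and the remaining linear factor must share it, since simple roots are
excluded. A regular matrix a + N would again be cyclic. -/
theorem exists_eq_of_isUncyclic_three {A : Matrix (Fin 3) (Fin 3) F} (hA : IsUncyclic A) :
    ∃ a : F, A.charpoly = (X - C a) ^ 3 ∧ aeval A ((X - C a) ^ 2) = 0 := by
  have hm := charpoly_monic A
  have hd : A.charpoly.natDegree = 3 := by simp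
  obtain ⟨a, ha⟩ : ∃ a, A.charpoly.IsRoot a := by
    by_contra! h
    have hi : Irreducible A.charpoly :=
      irreducible_of_degree_le_three_of_not_isRoot (by simp [hd]) h
    refine hA _ hm hi dvd_rfl ?_
    rw [primaryComponent_charpoly_eq_top A (pow_one _).symm]
    refine isCyclicSubspace_top_of_irreducible_charpoly _ ?_
    rwa [charpoly_vecMulLinear]
  have h2 : 2 ≤ A.charpoly.rootMultiplicity a := by
    have h1 := rootMultiplicity_ne_one_of_isUncyclic hA a
    have := (rootMultiplicity_pos hm.ne_zero).mpr ha
    omega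
  obtain ⟨h, hh⟩ := (le_rootMultiplicity_iff hm.ne_zero).mp h2
  have hhm : h.Monic := ((monic_X_sub_C a).pow 2).of_mul_monic_left (hh ▸ hm)
  have hhd : h.natDegree = 1 := by
    have := congrArg natDegree hh
    rw [hd, ((monic_X_sub_C a).pow 2).natDegree_mul hhm, natDegree_pow, natDegree_X_sub_C] at this
    omega
  obtain ⟨b, rfl⟩ : ∃ b, h = X - C b := ⟨-h.coeff 0, by
    rw [map_neg, sub_neg_eq_add]
    exact hhm.eq_X_add_C hhd⟩
  have hab : b = a := by
    by_contra hne
    refine rootMultiplicity_ne_one_of_isUncyclic hA b ?_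
    rw [hh, mul_comm]
    have := rootMultiplicity_pow_mul_pow hne 1 2
    rwa [pow_one] at this
  rw [hab, ← pow_succ] at hh
  refine ⟨a, hh, ?_⟩
  by_contra hne
  refine hA (X - C a) (monic_X_sub_C a) (irreducible_X_sub_C a)
    (hh ▸ dvd_pow_self _ (by norm_num)) ?_
  rw [primaryComponent_charpoly_eq_top A hh]
  have hψ : ∀ i, ((A.vecMulLinear : Module.End F (Fin 3 → F)) -
      a • (1 : Module.End F (Fin 3 → F))) ^ i = (aeval A ((X - C a) ^ i)).vecMulLinear := by
    intro i
    rw [← aeval_vecMulLinear]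
    simp [Algebra.algebraMap_eq_smul_one]
  refine isCyclicSubspace_top_of_regular _ a (m := 2) (by simp) ?_ ?_
  · rw [hψ, ← hh, aeval_self_charpoly]
    exact LinearMap.ext fun v => by simp
  · rw [hψ]
    intro h0
    apply hne
    rw [← Matrix.mulVecLin_transpose] at h0
    have : (aeval A ((X - C a) ^ 2))ᵀ = 0 := Matrix.toLin'.injective (by rw [map_zero]; exact h0)
    exact Matrix.transpose_eq_zero.mp this

end DimensionThree

/-! ### Numerical estimates -/

section Bounds

/-- Bounds |GL_(k+l)| / (|GL_k| |GL_l|) below, with k = i + 2. Raising k by one multiplies the left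
by 1 - x^(k+1) and the right by the larger 1 - x^(k+l+1). The base case k = 2 reduces to 1 - x^2 ≤
(1 - x^(l+1))(1 - x^(l+2)). -/
theorem oneSubPowProd_mul_le {x : ℝ} (h0 : 0 ≤ x) (h1 : x ≤ 1 / 2) (i : ℕ) {l : ℕ} (hl : 2 ≤ l) :
    oneSubPowProd x (i + 2) * oneSubPowProd x l ≤ (1 - x) * oneSubPowProd x (i + 2 + l) := by
  have hx1 : x < 1 := by linarith
  induction i with
  | zero =>
    have hpos := oneSubPowProd_pos h0 hx1 l
    have e : oneSubPowProd x 2 = (1 - x) * (1 - x ^ 2) := by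
      simp [oneSubPowProd, Finset.prod_range_succ]
    rw [zero_add, e, add_comm 2 l, show l + 2 = l + 1 + 1 from rfl, oneSubPowProd_succ,
      oneSubPowProd_succ]
    have a1 : x ^ (l + 1) ≤ x ^ 3 := pow_le_pow_of_le_one h0 hx1.le (by omega)
    have a2 : x ^ (l + 1 + 1) ≤ x ^ 4 := pow_le_pow_of_le_one h0 hx1.le (by omega)
    have b1 : 0 ≤ x ^ (l + 1) := by positivity
    have b2 : 0 ≤ x ^ (l + 1 + 1) := by positivity
    -- This is where x ≤ 1/2 enters: it makes 1 - x - x^2 nonnegative.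
    have a3 : x ^ 3 + x ^ 4 ≤ x ^ 2 := by
      nlinarith [mul_nonneg (sq_nonneg x) (by nlinarith : (0 : ℝ) ≤ 1 - x - x ^ 2)]
    have key : 1 - x ^ 2 ≤ (1 - x ^ (l + 1)) * (1 - x ^ (l + 1 + 1)) := by
      nlinarith [mul_nonneg b1 b2]
    have := mul_le_mul_of_nonneg_left key (mul_nonneg (by linarith : 0 ≤ 1 - x) hpos.le)
    linarith
  | succ i ih =>
    have e : i + 1 + 2 + l = i + 2 + l + 1 := by ring
    rw [e, show i + 1 + 2 = i + 2 + 1 from rfl, oneSubPowProd_succ x (i + 2),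
      oneSubPowProd_succ x (i + 2 + l)]
    have a1 : x ^ (i + 2 + l + 1) ≤ x ^ (i + 2 + 1) := pow_le_pow_of_le_one h0 hx1.le (by omega)
    have a2 : x ^ (i + 2 + 1) ≤ 1 := pow_le_one₀ h0 hx1.le
    have p := (oneSubPowProd_pos h0 hx1 (i + 2 + l)).le
    calc oneSubPowProd x (i + 2) * (1 - x ^ (i + 2 + 1)) * oneSubPowProd x l
        = oneSubPowProd x (i + 2) * oneSubPowProd x l * (1 - x ^ (i + 2 + 1)) := by ring
      _ ≤ (1 - x) * oneSubPowProd x (i + 2 + l) * (1 - x ^ (i + 2 + 1)) :=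
          mul_le_mul_of_nonneg_right ih (by linarith)
      _ ≤ (1 - x) * oneSubPowProd x (i + 2 + l) * (1 - x ^ (i + 2 + l + 1)) :=
          mul_le_mul_of_nonneg_left (by linarith) (mul_nonneg (by linarith) p)
      _ = _ := by ring

/-- Source of strictness for n ≥ 4: with three or more factors, 1 - x^4 < 1 is present. -/
theorem prod_one_sub_pow_lt {x : ℝ} (h0 : 0 < x) (h1 : x < 1) (i : ℕ) :
    ∏ j ∈ Finset.range (i + 3), (1 - x ^ (j + 2)) < (1 - x ^ 2) * (1 - x ^ 3) := by
  have hlt : ∀ j, x ^ (j + 2) < 1 := fun j => pow_lt_one₀ h0.le h1 (by omega)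
  have hx : ∀ j, 0 < x ^ (j + 2) := fun j => by positivity
  induction i with
  | zero =>
    have e : ∏ j ∈ Finset.range (0 + 3), (1 - x ^ (j + 2)) =
        (1 - x ^ 2) * (1 - x ^ 3) * (1 - x ^ 4) := by
      simp [Finset.prod_range_succ]
    rw [e]
    exact mul_lt_of_lt_one_right (mul_pos (sub_pos.mpr (hlt 0)) (sub_pos.mpr (hlt 1)))
      (sub_lt_self 1 (hx 2))
  | succ i ih =>
    rw [show i + 1 + 3 = i + 3 + 1 from rfl, Finset.prod_range_succ]
    refine lt_of_le_of_lt (mul_le_of_le_one_right ?_ (by linarith [hx (i + 3)])) ih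
    exact Finset.prod_nonneg fun j _ => by linarith [hlt j]

theorem prod_one_sub_pow_le {x : ℝ} (h0 : 0 < x) (h1 : x < 1) (i : ℕ) :
    ∏ j ∈ Finset.range (i + 1), (1 - x ^ (j + 2)) ≤ 1 - x ^ 2 := by
  have hlt : ∀ j, x ^ (j + 2) < 1 := fun j => pow_lt_one₀ h0.le h1 (by omega)
  have hx : ∀ j, 0 < x ^ (j + 2) := fun j => by positivity
  induction i with
  | zero => simp
  | succ i ih =>
    rw [Finset.prod_range_succ]
    refine le_trans (mul_le_of_le_one_right ?_ (by linarith [hx (i + 1)])) ih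
    exact Finset.prod_nonneg fun j _ => by linarith [hlt j]

variable {F : Type*} [Field F] [Finite F]

theorem inv_card_field_le_half : (Nat.card F : ℝ)⁻¹ ≤ 1 / 2 := by
  rw [one_div]
  exact inv_anti₀ two_pos two_le_card_field

/-- With k = i + 2, there are at least q^(k^2-k-2) non-regular nilpotents, since the product is at
most its first factor 1 - q^(-2). -/
theorem pow_le_card_nonregular_nilpotent (i : ℕ) :
    (Nat.card F : ℝ) ^ ((i + 2) ^ 2) ≤
      Nat.card {A : Matrix (Fin (i + 1 + 1)) (Fin (i + 1 + 1)) F // A ^ (i + 1) = 0} *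
        (Nat.card F : ℝ) ^ (i + 4) := by
  have hq := two_le_card_field (F := F)
  have hx := inv_card_field_le_half (F := F)
  have hx0 : (0 : ℝ) < (Nat.card F : ℝ)⁻¹ := by positivity
  have h := prod_one_sub_pow_le hx0 (by linarith) i
  rw [card_nonregular_nilpotent]
  set Q := (Nat.card F : ℝ)
  calc Q ^ ((i + 2) ^ 2) = Q ^ ((i + 1) ^ 2 + (i + 1)) * Q⁻¹ ^ 2 * Q ^ (i + 4) := by
        rw [show i + 4 = 2 + (i + 2) by ring, pow_add Q 2, inv_pow,
          show (i + 2) ^ 2 = (i + 1) ^ 2 + (i + 1) + (i + 2) by ring,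
          pow_add Q ((i + 1) ^ 2 + (i + 1))]
        field_simp
    _ ≤ _ := by
        gcongr
        linarith

/-- With n = i + j + 4, the family has at least q^(n^2-n-4)/(1 - 1/q) members; the factor 1 - 1/q
will cancel against the number of pairs {a, b}. -/
theorem pow_le_card_twoEigenvalue {i j : ℕ} {a b : F} (hab : a ≠ b) :
    (Nat.card F : ℝ) ^ ((i + 1 + 1 + (j + 1 + 1)) ^ 2) ≤
    Nat.card {M : Matrix (Fin (i + 1 + 1 + (j + 1 + 1))) (Fin (i + 1 + 1 + (j + 1 + 1))) F |
      M.charpoly = (X - C a) ^ (i + 1 + 1) * (X - C b) ^ (j + 1 + 1) ∧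
        aeval M ((X - C a) ^ (i + 1) * (X - C b) ^ (j + 1)) = 0} *
      ((Nat.card F : ℝ) ^ (i + j + 8) * (1 - (Nat.card F : ℝ)⁻¹)) := by
  have h := mul_le_card_twoEigenvalue (F := F) (i := i + 1) (j := j + 1) hab
  have h' := Nat.cast_le (α := ℝ).mpr h
  push_cast at h'
  rw [card_units_matrix, card_units_matrix, card_units_matrix] at h'
  have hq := two_le_card_field (F := F)
  have hx := inv_card_field_le_half (F := F)
  have hx0 : (0 : ℝ) < (Nat.card F : ℝ)⁻¹ := by positivity
  have hN := pow_le_card_nonregular_nilpotent (F := F) i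
  have hN' := pow_le_card_nonregular_nilpotent (F := F) j
  have hπ := oneSubPowProd_mul_le hx0.le hx i (l := j + 1 + 1) (by omega)
  have p1 := oneSubPowProd_pos hx0.le (by linarith) (i + 1 + 1)
  have p2 := oneSubPowProd_pos hx0.le (by linarith) (j + 1 + 1)
  have p3 := oneSubPowProd_pos hx0.le (by linarith) (i + 1 + 1 + (j + 1 + 1))
  set Q := (Nat.card F : ℝ)
  generalize (Nat.card {M : Matrix (Fin (i + 1 + 1 + (j + 1 + 1)))
    (Fin (i + 1 + 1 + (j + 1 + 1))) F |
      M.charpoly = (X - C a) ^ (i + 1 + 1) * (X - C b) ^ (j + 1 + 1) ∧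
        aeval M ((X - C a) ^ (i + 1) * (X - C b) ^ (j + 1)) = 0} : ℝ) = c at h' ⊢
  generalize (Nat.card {A : Matrix (Fin (i + 1 + 1)) (Fin (i + 1 + 1)) F // A ^ (i + 1) = 0} : ℝ)
    = N at h' hN
  generalize (Nat.card {A : Matrix (Fin (j + 1 + 1)) (Fin (j + 1 + 1)) F // A ^ (j + 1) = 0} : ℝ)
    = N' at h' hN'
  simp only [add_assoc, Nat.reduceAdd] at *
  set u := oneSubPowProd Q⁻¹ (i + 2)
  set v := oneSubPowProd Q⁻¹ (j + 2)
  set w := oneSubPowProd Q⁻¹ (i + (2 + (j + 2)))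
  set E := Q ^ ((i + (2 + (j + 2))) ^ 2)
  have hpos : 0 < Q ^ ((i + 2) ^ 2) * u * (Q ^ ((j + 2) ^ 2) * v) := by positivity
  refine le_of_mul_le_mul_right ?_ hpos
  have hE : 0 ≤ E := by positivity
  calc E * (Q ^ ((i + 2) ^ 2) * u * (Q ^ ((j + 2) ^ 2) * v))
      = E * (Q ^ ((i + 2) ^ 2) * Q ^ ((j + 2) ^ 2)) * (u * v) := by ring
    _ ≤ E * ((N * Q ^ (i + 4)) * (N' * Q ^ (j + 4))) * ((1 - Q⁻¹) * w) := by
        have hN0 : 0 ≤ N * Q ^ (i + 4) := le_trans (by positivity) hN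
        have hN0' : 0 ≤ N' * Q ^ (j + 4) := le_trans (by positivity) hN'
        have hNN := mul_nonneg hE (mul_nonneg hN0 hN0')
        gcongr
    _ = (E * w * (N * N')) * (Q ^ (i + (j + 8)) * (1 - Q⁻¹)) := by ring
    _ ≤ _ := by
        have : 0 ≤ Q ^ (i + (j + 8)) * (1 - Q⁻¹) := mul_nonneg (by positivity) (by linarith)
        refine (mul_le_mul_of_nonneg_right h' this).trans_eq ?_
        ring

end Bounds

/-! ### Disjointness of the chosen families -/

section Families

variable {F : Type*} [Field F]

/-- The characteristic polynomials of the uncyclic matrices with one eigenvalue and with two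
eigenvalues in `F`. -/
noncomputable def eigenCharpoly (n : ℕ) : F ⊕ (F × F) × ℕ → F[X]
  | .inl a => (X - C a) ^ n
  | .inr (p, k) => (X - C p.1) ^ k * (X - C p.2) ^ (n - k)

/-- The uncyclic matrices with one eigenvalue and with two eigenvalues in `F`. -/
def eigenFamily (n : ℕ) : F ⊕ (F × F) × ℕ → Set (Matrix (Fin n) (Fin n) F)
  | .inl a => {A | A.charpoly = (X - C a) ^ n ∧ aeval A ((X - C a) ^ (n - 1)) = 0}
  | .inr (p, k) => {A | A.charpoly = (X - C p.1) ^ k * (X - C p.2) ^ (n - k) ∧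
      aeval A ((X - C p.1) ^ (k - 1) * (X - C p.2) ^ (n - k - 1)) = 0}

/-- Root multiplicities recover the eigenvalues and k. The exchange of a and b together with k and n
- k is ruled out by `hP'`. -/
theorem eigenCharpoly_injOn {n : ℕ} (hn : 3 ≤ n) (S : Finset F) (P : Finset (F × F))
    (hP : ∀ p ∈ P, p.1 ≠ p.2) (hP' : ∀ p ∈ P, ∀ p' ∈ P, p.1 = p'.2 → p.2 ≠ p'.1) :
    Set.InjOn (eigenCharpoly (F := F) n)
      (S.disjSum (P ×ˢ Finset.Ico 2 (n - 1)) : Finset (F ⊕ (F × F) × ℕ)) := by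
  classical
  have h1 : ∀ a z : F, (eigenCharpoly n (.inl a)).rootMultiplicity z = if z = a then n else 0 := by
    intro a z
    have := rootMultiplicity_pow_mul_pow_apply a a z n 0
    simpa [eigenCharpoly] using this
  have h2 : ∀ (p : F × F) (k : ℕ) (z : F), (eigenCharpoly n (.inr (p, k))).rootMultiplicity z =
      (if z = p.1 then k else 0) + (if z = p.2 then n - k else 0) :=
    fun p k z => rootMultiplicity_pow_mul_pow_apply p.1 p.2 z k (n - k)
  have hne : ∀ (a : F) (p : F × F) (k : ℕ), p ∈ P → k ∈ Finset.Ico 2 (n - 1) →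
      eigenCharpoly n (.inl a) ≠ eigenCharpoly n (.inr (p, k)) := by
    intro a p k hp hk h
    have := congrArg (rootMultiplicity a) h
    rw [h1, h2, if_pos rfl] at this
    rw [Finset.mem_Ico] at hk
    by_cases ha : a = p.1
    · rw [if_pos ha, if_neg (ha ▸ hP p hp)] at this
      omega
    · rw [if_neg ha] at this
      split_ifs at this <;> omega
  rintro (a | ⟨p, k⟩) hi (a' | ⟨p', k'⟩) hi' h
  · have := congrArg (rootMultiplicity a) h
    rw [h1, h1, if_pos rfl] at this
    split_ifs at this with ha
    · rw [ha]
    · omega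
  · simp only [Finset.mem_coe, Finset.inr_mem_disjSum, Finset.mem_product] at hi'
    exact absurd h (hne a p' k' hi'.1 hi'.2)
  · simp only [Finset.mem_coe, Finset.inr_mem_disjSum, Finset.mem_product] at hi
    exact absurd h.symm (hne a' p k hi.1 hi.2)
  · simp only [Finset.mem_coe, Finset.inr_mem_disjSum, Finset.mem_product, Finset.mem_Ico] at hi hi'
    have e1 := congrArg (rootMultiplicity p.1) h
    have e2 := congrArg (rootMultiplicity p.2) h
    have hp := hP p hi.1
    have hp' := hP p' hi'.1
    have hpp := hP' p hi.1 p' hi'.1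
    rw [h2, h2, if_pos rfl, if_neg hp] at e1
    rw [h2, h2, if_pos rfl, if_neg hp.symm] at e2
    have m1 : p.1 = p'.1 ∨ p.1 = p'.2 := by
      by_contra! hcon
      rw [if_neg hcon.1, if_neg hcon.2] at e1
      omega
    have m2 : p.2 = p'.1 ∨ p.2 = p'.2 := by
      by_contra! hcon
      rw [if_neg hcon.1, if_neg hcon.2] at e2
      omega
    have q1 : p.1 = p'.1 := by
      rcases m1 with h | h
      · exact h
      · rcases m2 with h' | h'
        · exact absurd h' (hpp h)
        · exact absurd (h.trans h'.symm) hp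
    have q2 : p.2 = p'.2 := by
      rcases m2 with h' | h'
      · exact absurd (q1.trans h'.symm) hp
      · exact h'
    rw [q1, if_pos rfl, if_neg hp'] at e1
    have hk : k = k' := by simpa using e1
    rw [hk, Prod.ext q1 q2]

theorem eigenFamily_isUncyclic {n : ℕ} (hn : 3 ≤ n) (S : Finset F) (P : Finset (F × F))
    (hP : ∀ p ∈ P, p.1 ≠ p.2) (i : F ⊕ (F × F) × ℕ)
    (hi : i ∈ S.disjSum (P ×ˢ Finset.Ico 2 (n - 1))) (A : Matrix (Fin n) (Fin n) F)
    (hA : A ∈ eigenFamily n i) : A.charpoly = eigenCharpoly n i ∧ IsUncyclic A := by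
  rcases i with a | ⟨p, k⟩
  · exact ⟨hA.1, isUncyclic_of_charpoly_eq_pow A a (by omega) hA.1 hA.2⟩
  · simp only [Finset.inr_mem_disjSum, Finset.mem_product, Finset.mem_Ico] at hi
    exact ⟨hA.1, isUncyclic_of_charpoly_eq_pow_mul_pow A (hP p hi.1) (by omega) (by omega)
      hA.1 hA.2⟩

end Families

/-! ### Assembling the bounds -/

section Main

variable {F : Type*} [Field F] [Finite F]

theorem card_eigenFamily_inl {m : ℕ} (a : F) :
    (Nat.card (eigenFamily (m + 1) (.inl a : F ⊕ (F × F) × ℕ)) : ℝ) =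
      (Nat.card F : ℝ) ^ (m ^ 2 + m) *
        (1 - ∏ i ∈ Finset.range m, (1 - (Nat.card F : ℝ)⁻¹ ^ (i + 2))) := by
  rw [← card_nonregular_nilpotent, ← card_singleEigenvalue m a]
  rfl

theorem le_card_eigenFamily_inr {n k : ℕ} {p : F × F} (hp : p.1 ≠ p.2)
    (hk : k ∈ Finset.Ico 2 (n - 1)) :
    (Nat.card F : ℝ) ^ (n ^ 2) ≤ Nat.card (eigenFamily n (.inr (p, k) : F ⊕ (F × F) × ℕ)) *
      ((Nat.card F : ℝ) ^ (n + 4) * (1 - (Nat.card F : ℝ)⁻¹)) := by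
  rw [Finset.mem_Ico] at hk
  obtain ⟨i, rfl⟩ := Nat.exists_eq_add_of_le' hk.1
  obtain ⟨j, rfl⟩ : ∃ j, n = i + 1 + 1 + (j + 1 + 1) := ⟨n - i - 4, by omega⟩
  have h := pow_le_card_twoEigenvalue (i := i) (j := j) hp
  rw [show i + j + 8 = i + 1 + 1 + (j + 1 + 1) + 4 by ring] at h
  have e : eigenFamily (i + 1 + 1 + (j + 1 + 1)) (.inr (p, i + 2) : F ⊕ (F × F) × ℕ) =
      {M | M.charpoly = (X - C p.1) ^ (i + 1 + 1) * (X - C p.2) ^ (j + 1 + 1) ∧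
        aeval M ((X - C p.1) ^ (i + 1) * (X - C p.2) ^ (j + 1)) = 0} := by
    have e1 : i + 1 + 1 + (j + 1 + 1) - (i + 2) = j + 1 + 1 := by omega
    simp only [eigenFamily, e1]
    rfl
  rw [e]
  exact h

/-- The contributions of the matrices with one and with two eigenvalues in the field. -/
theorem le_unc {m : ℕ} (hm : 2 ≤ m) :
    (Nat.card F : ℝ) ^ (m ^ 2 + m) * ((Nat.card F : ℝ) *
        (1 - ∏ i ∈ Finset.range m, (1 - (Nat.card F : ℝ)⁻¹ ^ (i + 2))) +
      ((m : ℝ) - 2) / 2 * (Nat.card F : ℝ)⁻¹ ^ 2) ≤ unc (m + 1) F := by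
  classical
  have := Fintype.ofFinite F
  obtain ⟨P, hPc, hP, hP'⟩ := exists_finset_pairs F
  have h := sum_card_le_unc _ _ (eigenCharpoly_injOn (n := m + 1) (by omega) Finset.univ P hP hP')
    (eigenFamily (m + 1)) (eigenFamily_isUncyclic (by omega) Finset.univ P hP)
  have h' := Nat.cast_le (α := ℝ).mpr h
  rw [Nat.cast_sum, Finset.sum_disjSum, Finset.sum_congr rfl fun a _ => card_eigenFamily_inl a,
    Finset.sum_const, Finset.card_univ, ← Nat.card_eq_fintype_card, nsmul_eq_mul] at h'
  have hq := two_le_card_field (F := F)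
  have hx := inv_card_field_le_half (F := F)
  have hPc' : 2 * (P.card : ℝ) = Nat.card F * Nat.card F - Nat.card F := by
    rw [← Nat.cast_mul (Nat.card F), ← Nat.cast_sub (Nat.le_mul_self _), ← hPc]
    push_cast
    rfl
  set Q := (Nat.card F : ℝ) with hQ
  have hQ0 : Q ≠ 0 := by positivity
  have hx0 : 0 < Q⁻¹ := by positivity
  have hD : 0 < Q ^ (m + 1 + 4) * (1 - Q⁻¹) := mul_pos (by positivity) (by linarith)
  have hterm : ∀ i ∈ P ×ˢ Finset.Ico 2 (m + 1 - 1),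
      Q ^ ((m + 1) ^ 2) / (Q ^ (m + 1 + 4) * (1 - Q⁻¹)) ≤
        (Nat.card (eigenFamily (m + 1) (.inr i : F ⊕ (F × F) × ℕ)) : ℝ) := by
    rintro ⟨p, k⟩ hi
    rw [Finset.mem_product] at hi
    rw [div_le_iff₀ hD]
    exact le_card_eigenFamily_inr (hP p hi.1) hi.2
  have hsum := Finset.card_nsmul_le_sum _ _ _ hterm
  rw [Finset.card_product, Nat.card_Ico, nsmul_eq_mul, Nat.cast_mul, Nat.add_sub_cancel,
    Nat.cast_sub hm] at hsum
  refine le_trans ?_ ((add_le_add_right hsum _).trans h')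
  rw [mul_add]
  refine add_le_add (le_of_eq (by ring)) (le_of_eq ?_)
  -- The factor 1 - 1/q here cancels the one in the denominator of each term.
  have hP2 : (P.card : ℝ) = Q ^ 2 * (1 - Q⁻¹) / 2 := by
    have : Q ^ 2 * (1 - Q⁻¹) = Q * Q - Q := by field_simp
    rw [this, ← hPc']
    ring
  have hx1 : 1 - Q⁻¹ ≠ 0 := by linarith
  rw [hP2, show (m + 1) ^ 2 = m ^ 2 + m + (m + 1) by ring, pow_add Q (m ^ 2 + m),
    pow_add Q (m + 1) 4, inv_pow]
  generalize 1 - Q⁻¹ = y at hx1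
  push_cast
  field_simp

/-- For n = 3 the single-eigenvalue families exhaust the uncyclic matrices, so the union bound meets
the lower bound. -/
theorem unc_three_le :
    (unc 3 F : ℝ) ≤ (Nat.card F : ℝ) ^ (2 ^ 2 + 2) * ((Nat.card F : ℝ) *
        (1 - ∏ i ∈ Finset.range 2, (1 - (Nat.card F : ℝ)⁻¹ ^ (i + 2)))) := by
  classical
  have := Fintype.ofFinite F
  have h : unc 3 F ≤ ∑ a : F, Nat.card (eigenFamily 3 (.inl a : F ⊕ (F × F) × ℕ)) := by
    have h1 : ∀ a : F, Nat.card (eigenFamily 3 (.inl a : F ⊕ (F × F) × ℕ)) =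
        (eigenFamily 3 (.inl a : F ⊕ (F × F) × ℕ)).toFinset.card := fun a => by
      rw [Set.toFinset_card, Nat.card_eq_fintype_card]
    rw [unc, Nat.card_eq_fintype_card, Fintype.card_subtype, Finset.sum_congr rfl fun a _ => h1 a]
    refine le_trans (Finset.card_le_card fun A hA => ?_) Finset.card_biUnion_le
    obtain ⟨a, ha⟩ := exists_eq_of_isUncyclic_three (Finset.mem_filter.mp hA).2
    rw [Finset.mem_biUnion]
    exact ⟨a, Finset.mem_univ a, Set.mem_toFinset.mpr ha⟩
  have h' := Nat.cast_le (α := ℝ).mpr h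
  rw [Nat.cast_sum, Finset.sum_congr rfl fun a _ => card_eigenFamily_inl (m := 2) a,
    Finset.sum_const, Finset.card_univ, ← Nat.card_eq_fintype_card, nsmul_eq_mul] at h'
  linarith

end Main

theorem theoremT {F : Type*} [Field F] [Finite F] (q n : ℕ) (hq : Nat.card F = q)
    (hn : 3 ≤ n) :
    (q : ℝ) ^ (n ^ 2 - n - 1) * (1 + ((n : ℝ) - 1) / 2 * (q : ℝ)⁻¹ - ((q : ℝ) ^ 3)⁻¹)
        ≤ (unc n F : ℝ) ∧
      ((q : ℝ) ^ (n ^ 2 - n - 1) * (1 + ((n : ℝ) - 1) / 2 * (q : ℝ)⁻¹ - ((q : ℝ) ^ 3)⁻¹)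
        = (unc n F : ℝ) ↔ n = 3) := by
  subst hq
  obtain ⟨m, rfl⟩ : ∃ m, n = m + 1 := ⟨n - 1, by omega⟩
  have hm : 2 ≤ m := by omega
  have hlow := le_unc (F := F) hm
  have h3 := unc_three_le (F := F)
  have hq := two_le_card_field (F := F)
  have hx := inv_card_field_le_half (F := F)
  set Q := (Nat.card F : ℝ) with hQ
  have hQ0 : Q ≠ 0 := by positivity
  have hx0 : 0 < Q⁻¹ := by positivity
  have hpow : Q ^ (m ^ 2 + m) = Q ^ ((m + 1) ^ 2 - (m + 1) - 1) * Q := by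
    have : (m + 1) ^ 2 - (m + 1) - 1 + 1 = m ^ 2 + m := by
      have : (m + 1) ^ 2 = m ^ 2 + m + (m + 1) := by ring
      rw [this, Nat.add_sub_cancel]
      exact Nat.sub_add_cancel (by nlinarith)
    rw [← pow_succ, this]
  -- With x = 1/Q, 1 - (1 - x^2)(1 - x^3) = x^2 + x^3 - x^5, so the stated bound is `hlow` with the
  -- product cut to two factors.
  have hval : Q ^ ((m + 1) ^ 2 - (m + 1) - 1) *
      (1 + (((m + 1 : ℕ) : ℝ) - 1) / 2 * Q⁻¹ - (Q ^ 3)⁻¹) =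
      Q ^ (m ^ 2 + m) * (Q * (1 - (1 - Q⁻¹ ^ 2) * (1 - Q⁻¹ ^ 3)) +
        ((m : ℝ) - 2) / 2 * Q⁻¹ ^ 2) := by
    rw [hpow]
    push_cast
    field_simp
    ring
  have hpos : 0 < Q ^ (m ^ 2 + m) := by positivity
  rw [hval]
  rcases hm.eq_or_lt with rfl | hm3
  · have e : ∏ i ∈ Finset.range 2, (1 - Q⁻¹ ^ (i + 2)) = (1 - Q⁻¹ ^ 2) * (1 - Q⁻¹ ^ 3) := by
      simp [Finset.prod_range_succ]
    rw [e] at hlow h3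
    refine ⟨hlow, fun _ => rfl, fun _ => le_antisymm hlow ?_⟩
    refine h3.trans (le_of_eq ?_)
    push_cast
    ring
  · obtain ⟨i, rfl⟩ : ∃ i, m = i + 3 := ⟨m - 3, by omega⟩
    have hlt := prod_one_sub_pow_lt hx0 (by linarith) i
    have hs := lt_of_lt_of_le (mul_lt_mul_of_pos_left (add_lt_add_left
      (mul_lt_mul_of_pos_left (sub_lt_sub_left hlt 1) (by linarith : 0 < Q)) _) hpos) hlow
    exact ⟨hs.le, fun h => absurd h hs.ne, fun h => by omega⟩
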